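/- Let $\widehat f(\xi)=(2\pi)^{-1/2}\int_{\mathbb R}e^{-i\xi x}f(x)\,dx$ be the Fourier transform, extended by duality to the tempered distributions $\mathcal S'(\mathbb R)$, and let $H^{-1}(\mathbb R)$ be the space of all $V\in\mathcal S'(\mathbb R)$ with $(1+|\cdot|^2)^{-1/2}\,\widehat V\in L^2(\mathbb R)$; for such $V$, $\widehat V$ is a locally integrable function. Let $H_0=-d^2/dx^2$ with domain $H^2(\mathbb R)$ in $L^2(\mathbb R)$; for $\kappa>0$ the operator $(H_0+\kappa^2)^{-1/2}$ acts on $L^2(\mathbb R)$, and also on $\mathcal S(\mathbb R)$ and on $\mathcal S'(\mathbb R)$, as the Fourier multiplier $(|\xi|^2+\kappa^2)^{-1/2}$. For $V\in\mathcal S'(\mathbb R)$ and $\kappa>0$, the map $$\mathcal S(\mathbb R)\ni\varphi\mapsto(H_0+\kappa^2)^{-1/2}\bigl[V\cdot(H_0+\kappa^2)^{-1/2}\varphi\bigr]\in\mathcal S'(\mathbb R)$$ is well defined; if it takes values in $L^2(\mathbb R)$ and extends to a (necessarily unique) bounded operator on $L^2(\mathbb R)$, this bounded operator is denoted by $(H_0+\kappa^2)^{-1/2}V(H_0+\kappa^2)^{-1/2}$.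 **Proposition.** Let $V\in\mathcal S'(\mathbb R)$. (i) If $V\in H^{-1}(\mathbb R)$, then for every $\kappa\in(0,\infty)$ the operator $(H_0+\kappa^2)^{-1/2}V(H_0+\kappa^2)^{-1/2}$ exists as a bounded operator on $L^2(\mathbb R)$ and is Hilbert–Schmidt, and $$\bigl\|(H_0+\kappa^2)^{-1/2}V(H_0+\kappa^2)^{-1/2}\bigr\|_{\mathcal B_2(L^2(\mathbb R))}^2=\frac1\kappa\int_{\mathbb R}\frac{|\widehat V(\xi)|^2}{\xi^2+4\kappa^2}\,d\xi<\infty .$$ In particular, $$\lim_{\kappa\to\infty}\bigl\|(H_0+\kappa^2)^{-1/2}V(H_0+\kappa^2)^{-1/2}\bigr\|_{\mathcal B_2(L^2(\mathbb R))}=0 .$$ (ii) For every $\kappa\in(0,\infty)$, the operator $(H_0+\kappa^2)^{-1/2}V(H_0+\kappa^2)^{-1/2}$ exists as a bounded operator on $L^2(\mathbb R)$ and is Hilbert–Schmidt if and only if $V\in H^{-1}(\mathbb R)$. -/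

import Mathlib

open MeasureTheory Filter Topology
open scoped SchwartzMap FourierTransform ENNReal

noncomputable section

/-! ### Hilbert–Schmidt operators -/

section HilbertSchmidt

variable {E F : Type*} [NormedAddCommGroup E] [InnerProductSpace ℂ E] [CompleteSpace E]
  [NormedAddCommGroup F] [InnerProductSpace ℂ F] [CompleteSpace F]

set_option linter.unusedSectionVars false

/-- The squared Hilbert–Schmidt norm `∑ᵢ ‖T eᵢ‖²`, with values in `[0, ∞]`, computed in some
orthonormal (Hilbert) basis; by `hsNormSq_eq_tsum` below every Hilbert basis gives this value. -/
def hsNormSq (T : E →L[ℂ] F) : ℝ≥0∞ :=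
  ∑' i : (exists_hilbertBasis ℂ E).choose,
    ‖T ((exists_hilbertBasis ℂ E).choose_spec.choose i)‖ₑ ^ 2

/-- `T` is a Hilbert–Schmidt operator, i.e. `T ∈ 𝓑₂(E, F)`. -/
def IsHilbertSchmidt (T : E →L[ℂ] F) : Prop :=
  hsNormSq T < ⊤

/-- The Hilbert–Schmidt norm (meaningful for Hilbert–Schmidt operators). -/
def hsNorm (T : E →L[ℂ] F) : ℝ :=
  √(hsNormSq T).toReal

theorem HilbertBasis.tsum_enorm_inner_sq {ι : Type*} (b : HilbertBasis ι ℂ E) (x : E) :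
    ∑' i, ‖inner ℂ (b i) x‖ₑ ^ 2 = ‖x‖ₑ ^ 2 := by
  have h : HasSum (fun i => ‖inner ℂ (b i) x‖ ^ 2) (‖x‖ ^ 2) := by
    have := (b.hasSum_inner_mul_inner x x).mapL Complex.reCLM
    have h2 : Complex.reCLM (inner ℂ x x) = ‖x‖ ^ 2 := by
      rw [inner_self_eq_norm_sq_to_K]; norm_cast
    rw [h2] at this
    convert this using 2 with i
    rw [← inner_conj_symm x (b i), Complex.reCLM_apply, ← Complex.normSq_eq_conj_mul_self,
      Complex.ofReal_re, Complex.normSq_eq_norm_sq]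
  have h3 := ENNReal.ofReal_tsum_of_nonneg (fun i => sq_nonneg ‖inner ℂ (b i) x‖) h.summable
  rw [h.tsum_eq] at h3
  simp only [ENNReal.ofReal_pow (norm_nonneg _), ofReal_norm] at h3
  exact h3.symm

theorem tsum_enorm_adjoint {ι κ : Type*} (b : HilbertBasis ι ℂ E) (c : HilbertBasis κ ℂ F)
    (T : E →L[ℂ] F) :
    ∑' i, ‖T (b i)‖ₑ ^ 2 = ∑' j, ‖ContinuousLinearMap.adjoint T (c j)‖ₑ ^ 2 := by
  simp_rw [← c.tsum_enorm_inner_sq (T _), ← b.tsum_enorm_inner_sq (ContinuousLinearMap.adjoint T _)]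
  rw [ENNReal.tsum_comm]
  refine tsum_congr fun j => tsum_congr fun i => ?_
  rw [ContinuousLinearMap.adjoint_inner_right, ← inner_conj_symm, RCLike.enorm_conj]

/-- The Hilbert–Schmidt norm may be computed in any Hilbert basis. -/
theorem hsNormSq_eq_tsum {ι : Type*} (b : HilbertBasis ι ℂ E) (T : E →L[ℂ] F) :
    hsNormSq T = ∑' i, ‖T (b i)‖ₑ ^ 2 := by
  obtain ⟨w, c, -⟩ := exists_hilbertBasis ℂ F
  rw [hsNormSq, tsum_enorm_adjoint _ c, tsum_enorm_adjoint b c]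

end HilbertSchmidt

/-! ### The Fourier transform in the unitary, angular-frequency convention -/

/-- The Fourier transform `φ̂(ξ) = (2π)^{-1/2} ∫ e^{-iξx} φ(x) dx` on Schwartz functions
(see `angularFourier_apply`). -/
def angularFourier : 𝓢(ℝ, ℂ) →L[ℂ] 𝓢(ℝ, ℂ) :=
  (((2 * Real.pi) ^ (-(1 / 2) : ℝ) : ℝ) : ℂ) •
    (SchwartzMap.compCLMOfContinuousLinearEquiv ℂ
      (ContinuousLinearEquiv.unitsEquivAut ℝ
        (Units.mk0 (2 * Real.pi)⁻¹ (inv_ne_zero Real.two_pi_pos.ne')))) ∘L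
    FourierTransform.fourierCLM ℂ 𝓢(ℝ, ℂ)

theorem angularFourier_apply (φ : 𝓢(ℝ, ℂ)) (ξ : ℝ) :
    angularFourier φ ξ =
      (((2 * Real.pi) ^ (-(1 / 2) : ℝ) : ℝ) : ℂ) *
        ∫ x : ℝ, Complex.exp (-(Complex.I * ξ * x)) * φ x := by
  have h : (2 * Real.pi) ≠ 0 := Real.two_pi_pos.ne'
  simp only [angularFourier, _root_.smul_apply, smul_eq_mul,
    ContinuousLinearMap.comp_apply, SchwartzMap.compCLMOfContinuousLinearEquiv_apply,
    Function.comp_apply, FourierTransform.fourierCLM_apply, SchwartzMap.fourier_coe,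
    Real.fourier_eq']
  congr 1
  refine integral_congr_ae (Eventually.of_forall fun x => ?_)
  simp only [ContinuousLinearEquiv.unitsEquivAut_apply, Units.val_mk0]
  congr 2
  simp only [RCLike.inner_apply, conj_trivial]
  push_cast
  have h' : (Real.pi : ℂ) ≠ 0 := by exact_mod_cast Real.pi_ne_zero
  field_simp

/-- The function `v` is the Fourier transform `V̂` (unitary, angular-frequency convention) of the
tempered distribution `V`: the distribution `φ ↦ V(φ̂)` is integration against `v`. -/
def IsFourierFunction (V : 𝓢'(ℝ, ℂ)) (v : ℝ → ℂ) : Prop :=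
  LocallyIntegrable v ∧
    ∀ φ : 𝓢(ℝ, ℂ), Integrable (fun ξ => φ ξ * v ξ) ∧ V (angularFourier φ) = ∫ ξ, φ ξ * v ξ

/-- `V̂` is unique as a function up to null sets. -/
theorem IsFourierFunction.ae_eq {V : 𝓢'(ℝ, ℂ)} {v w : ℝ → ℂ}
    (hv : IsFourierFunction V v) (hw : IsFourierFunction V w) : v =ᵐ[volume] w := by
  refine ae_eq_of_integral_contDiff_smul_eq hv.1 hw.1 fun g hg hgc => ?_
  have hg₁ : HasCompactSupport (Complex.ofRealCLM ∘ g) := hgc.comp_left rfl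
  have hg₂ : ContDiff ℝ ((⊤ : ℕ∞) : WithTop ℕ∞) (Complex.ofRealCLM ∘ g) := by fun_prop
  have h1 := (hv.2 (hg₁.toSchwartzMap hg₂)).2
  have h2 := (hw.2 (hg₁.toSchwartzMap hg₂)).2
  simpa using h1.symm.trans h2

/-! ### The operators `(H₀ + κ²)^{-1/2}` and `(H₀ + κ²)^{-1/2} V (H₀ + κ²)^{-1/2}` -/

/-- The Hilbert space `L²(ℝ)` of complex-valued functions. -/
abbrev L2R : Type := Lp (α := ℝ) ℂ 2 volume

/-- The function `(|2πξ|² + κ²)^{-1/2}`. Mathlib's `𝓕` uses `e^{-2πixξ}`, so that the operator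
`H₀ = -d²/dx²` is multiplication by `(2πξ)²` on the Fourier side. -/
def freeSymbol (κ : ℝ) (ξ : ℝ) : ℂ :=
  ((((2 * Real.pi * ξ) ^ 2 + κ ^ 2) ^ (-(1 / 2) : ℝ) : ℝ) : ℂ)

/-- `(H₀ + κ²)^{-1/2}` on tempered distributions, where `H₀ = -d²/dx²`; for `κ > 0` it restricts to
the positive square root of the resolvent `(H₀ + κ²)^{-1}` on `L²(ℝ)`
(see `freeInvSqrt_sq` and `freeInvSqrt_isPositive`). -/
def freeInvSqrt (κ : ℝ) : 𝓢'(ℝ, ℂ) →L[ℂ] 𝓢'(ℝ, ℂ) :=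
  TemperedDistribution.fourierMultiplierCLM ℂ (freeSymbol κ)

/-- `(H₀ + κ²)^{-1/2}` on Schwartz functions. -/
def freeInvSqrtSchwartz (κ : ℝ) : 𝓢(ℝ, ℂ) →L[ℂ] 𝓢(ℝ, ℂ) :=
  SchwartzMap.fourierMultiplierCLM ℂ (freeSymbol κ)

theorem freeSymbol_hasTemperateGrowth {κ : ℝ} (hκ : 0 < κ) :
    (freeSymbol κ).HasTemperateGrowth := by
  have h := (Function.hasTemperateGrowth_one_add_norm_sq_rpow ℝ (-(1 / 2))).comp
    ((2 * Real.pi / κ) • ContinuousLinearMap.id ℝ ℝ).hasTemperateGrowth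
  have h' : (fun ξ : ℝ => Complex.ofReal
      (κ⁻¹ * (1 + ‖((2 * Real.pi / κ) • ContinuousLinearMap.id ℝ ℝ) ξ‖ ^ 2) ^ (-(1 / 2) : ℝ))
      ).HasTemperateGrowth := by
    have := (Function.HasTemperateGrowth.const (E := ℝ) κ⁻¹).mul h
    exact (Complex.ofRealCLM.hasTemperateGrowth).comp this
  convert h' using 1
  ext ξ
  rw [freeSymbol]
  congr 1
  have e : (2 * Real.pi * ξ) ^ 2 + κ ^ 2 =
      κ ^ 2 * (1 + ‖((2 * Real.pi / κ) • ContinuousLinearMap.id ℝ ℝ) ξ‖ ^ 2) := by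
    simp only [_root_.smul_apply, ContinuousLinearMap.id_apply, smul_eq_mul,
      Real.norm_eq_abs, sq_abs]
    field_simp
    ring
  rw [e, Real.mul_rpow (by positivity) (by positivity), ← Real.rpow_natCast,
    ← Real.rpow_mul hκ.le]
  norm_num [Real.rpow_neg_one]

/-- Both realizations of `(H₀ + κ²)^{-1/2}` agree on Schwartz functions. -/
theorem freeInvSqrt_coe {κ : ℝ} (hκ : 0 < κ) (φ : 𝓢(ℝ, ℂ)) :
    freeInvSqrt κ (φ : 𝓢'(ℝ, ℂ)) = (freeInvSqrtSchwartz κ φ : 𝓢(ℝ, ℂ)) :=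
  TemperedDistribution.fourierMultiplierCLM_toTemperedDistributionCLM_eq
    (freeSymbol_hasTemperateGrowth hκ) φ

theorem freeSymbol_mul_self {κ : ℝ} (hκ : 0 < κ) (ξ : ℝ) :
    freeSymbol κ ξ * freeSymbol κ ξ * ((2 * Real.pi * ξ) ^ 2 + κ ^ 2 : ℂ) = 1 := by
  have h : 0 < (2 * Real.pi * ξ) ^ 2 + κ ^ 2 := by positivity
  rw [freeSymbol, ← Complex.ofReal_mul, ← Real.rpow_add h]
  norm_num [Real.rpow_neg_one]
  rw [inv_mul_cancel₀]
  have := Complex.ofReal_ne_zero.mpr h.ne'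
  push_cast at this ⊢
  exact this

/-- `-d²/dx² + κ²` on tempered distributions, as a Fourier multiplier. -/
theorem neg_laplacian_add_eq (κ : ℝ) (w : 𝓢'(ℝ, ℂ)) :
    -Laplacian.laplacian w + (κ ^ 2 : ℂ) • w =
      TemperedDistribution.fourierMultiplierCLM ℂ
        (fun x : ℝ => ((2 * Real.pi * x) ^ 2 + κ ^ 2 : ℂ)) w := by
  have hn : (fun x : ℝ => Complex.ofReal (‖x‖ ^ 2)).HasTemperateGrowth := by fun_prop
  have hn' : (fun x : ℝ => ((2 * Real.pi : ℂ) ^ 2 • fun x : ℝ => Complex.ofReal (‖x‖ ^ 2)) x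
      ).HasTemperateGrowth := by
    simp only [Pi.smul_apply, smul_eq_mul]
    fun_prop
  have hc : (fun _ : ℝ => (κ ^ 2 : ℂ)).HasTemperateGrowth := by fun_prop
  have h1 : (fun x : ℝ => ((2 * Real.pi * x) ^ 2 + κ ^ 2 : ℂ)) =
      ((2 * Real.pi : ℂ) ^ 2 • fun x : ℝ => Complex.ofReal (‖x‖ ^ 2)) +
        fun _ : ℝ => (κ ^ 2 : ℂ) := by
    ext x
    simp [Real.norm_eq_abs, sq_abs, ← Complex.ofReal_pow]
    push_cast
    ring
  rw [h1, TemperedDistribution.laplacian_eq_fourierMultiplierCLM,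
    TemperedDistribution.fourierMultiplierCLM_apply ((_ : ℝ → ℂ) + _),
    TemperedDistribution.smulLeftCLM_add hn' hc,
    TemperedDistribution.smulLeftCLM_smul hn, TemperedDistribution.fourierMultiplierCLM_apply]
  simp only [_root_.add_apply, _root_.smul_apply,
    TemperedDistribution.smulLeftCLM_const, FourierTransform.fourierInv_add,
    FourierTransform.fourierInv_smul, FourierTransform.fourierInv_fourier_eq]
  congr 1
  rw [neg_smul, neg_neg]
  norm_cast

/-- The square of `(H₀ + κ²)^{-1/2}` is the inverse of `-d²/dx² + κ²`. -/
theorem freeInvSqrt_sq {κ : ℝ} (hκ : 0 < κ) (u : 𝓢'(ℝ, ℂ)) :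
    -Laplacian.laplacian (freeInvSqrt κ (freeInvSqrt κ u)) +
        (κ ^ 2 : ℂ) • freeInvSqrt κ (freeInvSqrt κ u) = u ∧
      freeInvSqrt κ (freeInvSqrt κ (-Laplacian.laplacian u + (κ ^ 2 : ℂ) • u)) = u := by
  have hm := freeSymbol_hasTemperateGrowth hκ
  have hp : (fun x : ℝ => ((2 * Real.pi * x) ^ 2 + κ ^ 2 : ℂ)).HasTemperateGrowth := by fun_prop
  constructor
  · rw [neg_laplacian_add_eq, freeInvSqrt,
      TemperedDistribution.fourierMultiplierCLM_fourierMultiplierCLM_apply hm hm,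
      TemperedDistribution.fourierMultiplierCLM_fourierMultiplierCLM_apply (hm.mul hm) hp]
    have : freeSymbol κ * freeSymbol κ * (fun x : ℝ => ((2 * Real.pi * x) ^ 2 + κ ^ 2 : ℂ)) =
        fun _ => 1 := funext fun ξ => freeSymbol_mul_self hκ ξ
    rw [this]
    simp
  · rw [neg_laplacian_add_eq, freeInvSqrt,
      TemperedDistribution.fourierMultiplierCLM_fourierMultiplierCLM_apply hp hm,
      TemperedDistribution.fourierMultiplierCLM_fourierMultiplierCLM_apply (hp.mul hm) hm]
    have : (fun x : ℝ => ((2 * Real.pi * x) ^ 2 + κ ^ 2 : ℂ)) * freeSymbol κ * freeSymbol κ =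
        fun _ => 1 := by
      funext ξ
      rw [← freeSymbol_mul_self hκ ξ]
      simp only [Pi.mul_apply]
      ring
    rw [this]
    simp

theorem freeSymbol_memLp {κ : ℝ} (hκ : 0 < κ) : MemLp (freeSymbol κ) ⊤ (volume : Measure ℝ) := by
  refine memLp_top_of_bound
    (freeSymbol_hasTemperateGrowth hκ).1.continuous.aestronglyMeasurable
    ((κ ^ 2) ^ (-(1 / 2) : ℝ)) (Eventually.of_forall fun ξ => ?_)
  rw [freeSymbol, Complex.norm_real, Real.norm_eq_abs, abs_of_nonneg (by positivity)]
  exact Real.rpow_le_rpow_of_nonpos (by positivity) (by nlinarith [sq_nonneg (2 * Real.pi * ξ)])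
    (by norm_num)

/-- On `L²(ℝ)`, `(H₀ + κ²)^{-1/2}` is a bounded positive self-adjoint operator. -/
theorem freeInvSqrt_isPositive {κ : ℝ} (hκ : 0 < κ) :
    ∃ T : L2R →L[ℂ] L2R, T.IsPositive ∧
      ∀ f : L2R, ((T f : L2R) : 𝓢'(ℝ, ℂ)) = freeInvSqrt κ (f : 𝓢'(ℝ, ℂ)) := by
  have hm := freeSymbol_hasTemperateGrowth hκ
  have hL := freeSymbol_memLp hκ
  set U : L2R ≃ₗᵢ[ℂ] L2R := Lp.fourierTransformₗᵢ ℝ ℂ with hU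
  obtain ⟨M, hM⟩ : ∃ M : L2R →L[ℂ] L2R, ∀ f : L2R, M f = (hL.toLp (freeSymbol κ)) • f :=
    ⟨LinearMap.mkContinuous
      { toFun := fun f => (hL.toLp (freeSymbol κ)) • f
        map_add' := fun f g => Lp.add_smul (hL.toLp (freeSymbol κ)) f g
        map_smul' := fun c f => (Lp.smul_comm c (hL.toLp (freeSymbol κ)) f).symm }
      ‖hL.toLp (freeSymbol κ)‖ fun f => Lp.norm_smul_le (hL.toLp (freeSymbol κ)) f, fun f => rfl⟩
  refine ⟨(U.symm : L2R →L[ℂ] L2R) ∘L M ∘L (U : L2R →L[ℂ] L2R), ?_, fun f => ?_⟩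
  · rw [ContinuousLinearMap.isPositive_iff_complex]
    intro f
    have h1 : inner ℂ (((U.symm : L2R →L[ℂ] L2R) ∘L M ∘L (U : L2R →L[ℂ] L2R)) f) f =
        inner ℂ (M (U f)) (U f) := by
      rw [← U.inner_map_map]
      simp
    have h2 : inner ℂ (M (U f)) (U f) =
        ((∫ ξ, ((2 * Real.pi * ξ) ^ 2 + κ ^ 2) ^ (-(1 / 2) : ℝ) * ‖(U f : ℝ → ℂ) ξ‖ ^ 2 : ℝ) : ℂ) := by
      rw [L2.inner_def, ← integral_complex_ofReal]
      refine integral_congr_ae ?_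
      rw [hM]
      filter_upwards [Lp.coeFn_lpSMul (r := 2) (hL.toLp (freeSymbol κ)) (U f), hL.coeFn_toLp]
        with ξ hξ hξ'
      rw [hξ, Pi.smul_apply', hξ', smul_eq_mul, RCLike.inner_apply, map_mul, freeSymbol,
        Complex.conj_ofReal]
      push_cast
      rw [← Complex.conj_mul']
      ring
    rw [h1, h2]
    refine ⟨by simp, ?_⟩
    simp only [RCLike.re_to_complex, Complex.ofReal_re]
    exact integral_nonneg fun ξ => by positivity
  · have h1 : ((M (𝓕 f) : L2R) : 𝓢'(ℝ, ℂ)) =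
        TemperedDistribution.smulLeftCLM ℂ (freeSymbol κ) ((𝓕 f : L2R) : 𝓢'(ℝ, ℂ)) := by
      rw [hM]
      exact Lp.toTemperedDistribution_smul_eq hm hL _
    rw [freeInvSqrt, TemperedDistribution.fourierMultiplierCLM_apply,
      Lp.fourier_toTemperedDistribution_eq, ← h1, Lp.fourierInv_toTemperedDistribution_eq]
    rfl

/-- The bounded operator `A` on `L²(ℝ)` is `(H₀ + κ²)^{-1/2} V (H₀ + κ²)^{-1/2}`: on the dense
subspace of Schwartz functions `φ` it is obtained by applying `(H₀ + κ²)^{-1/2}` to `φ`,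
multiplying the resulting Schwartz function by the distribution `V`, and applying
`(H₀ + κ²)^{-1/2}` to the tempered distribution so obtained. For given `V` and `κ` there is at most
one such `A` (see `IsSandwich.unique`). -/
def IsSandwich (κ : ℝ) (V : 𝓢'(ℝ, ℂ)) (A : L2R →L[ℂ] L2R) : Prop :=
  ∀ φ : 𝓢(ℝ, ℂ), ((A (φ.toLp 2) : L2R) : 𝓢'(ℝ, ℂ)) =
    freeInvSqrt κ (TemperedDistribution.smulLeftCLM ℂ (⇑(freeInvSqrtSchwartz κ φ)) V)

theorem IsSandwich.unique {κ : ℝ} {V : 𝓢'(ℝ, ℂ)} {A B : L2R →L[ℂ] L2R}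
    (hA : IsSandwich κ V A) (hB : IsSandwich κ V B) : A = B := by
  have hinj : Function.Injective (Lp.toTemperedDistributionCLM ℂ (volume : Measure ℝ) 2) :=
    LinearMap.ker_eq_bot.mp Lp.ker_toTemperedDistributionCLM_eq_bot
  have hd := SchwartzMap.denseRange_toLpCLM (E := ℝ) (F := ℂ) (p := 2) (μ := volume)
    ENNReal.ofNat_ne_top
  refine ContinuousLinearMap.coeFn_injective (hd.equalizer A.continuous B.continuous ?_)
  ext1 φ
  exact hinj ((hA φ).trans (hB φ).symm)

end

/-! Write `m` for `freeSymbol κ` and `w` for `𝓕 V`. Conjugated by the Fourier transform, the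
sandwiched operator has integral kernel `m(ξ) w(ξ - η) m(η)`, and its squared Hilbert–Schmidt norm
is the squared `L²` norm of that kernel. The shear `ξ = ζ + η` turns this into the integral over `ζ`
of `|w(ζ)|²` times the correlation of `|m|²` with itself. A correlation of two Lorentzians of width
`κ` is a Lorentzian of width `2κ`, with prefactor `1/κ`: this is the stated formula
(`hsNormSq_kernelOperator`, `lintegral_freeSymbol_sq_mul`, `IsFourierWeight.exists_sandwich`).

For the converse `𝓕 V` is not known to be a function, so `V` is first multiplied by Schwartz cutoffs
`g`. Applying the operator `A` to `(H₀ + κ²)^{1/2} g` shows that `gV` lies in `H⁻¹`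
(`IsSandwich.memSobolev_smul`), so the formula holds for `gV`. Multiplication by `g` is bounded on
`H¹` by a constant depending only on `κ` and on bounds for `g` and `g'`, hence the operator of `gV`
is dominated by `A` (`IsSandwich.norm_le_of_smul`). The `H⁻¹` norms of `gV` therefore stay bounded
as `g` spreads out to `1`. Passing to the limit on test functions and applying Riesz gives `V ∈ H⁻¹`
(`IsSandwich.memSobolev`). -/

/-! ### Hilbert–Schmidt norms and `L²` preliminaries -/

theorem hsNormSq_conj_isometry {E F : Type*} [NormedAddCommGroup E] [InnerProductSpace ℂ E]
    [CompleteSpace E] [NormedAddCommGroup F] [InnerProductSpace ℂ F] [CompleteSpace F]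
    (U : E ≃ₗᵢ[ℂ] F) (T : F →L[ℂ] F) :
    hsNormSq ((U.symm : F →L[ℂ] E) ∘L T ∘L (U : E →L[ℂ] F)) = hsNormSq T := by
  obtain ⟨s, b, -⟩ := exists_hilbertBasis ℂ E
  rw [hsNormSq_eq_tsum b, hsNormSq_eq_tsum (HilbertBasis.ofRepr (U.symm.trans b.repr))]
  refine tsum_congr fun i => ?_
  classical
  have h : HilbertBasis.ofRepr (U.symm.trans b.repr) i = U (b i) := by
    rw [← HilbertBasis.repr_symm_single, ← b.repr_symm_single]
    rfl
  rw [h]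
  simp [← ofReal_norm]

/-- Both sums run over the same basis of `E`, so they compare term by term. No factorization of `S`
through `T` is needed. -/
theorem hsNormSq_le_of_norm_le {E F G : Type*} [NormedAddCommGroup E] [InnerProductSpace ℂ E]
    [CompleteSpace E] [NormedAddCommGroup F] [InnerProductSpace ℂ F] [CompleteSpace F]
    [NormedAddCommGroup G] [InnerProductSpace ℂ G] [CompleteSpace G]
    {S : E →L[ℂ] F} {T : E →L[ℂ] G} {C : ℝ} (hC : 0 ≤ C) (h : ∀ x, ‖S x‖ ≤ C * ‖T x‖) :
    hsNormSq S ≤ ENNReal.ofReal C ^ 2 * hsNormSq T := by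
  rw [hsNormSq, hsNormSq, ← ENNReal.tsum_mul_left]
  refine ENNReal.tsum_le_tsum fun i => ?_
  rw [← mul_pow]
  gcongr
  rw [← ofReal_norm, ← ofReal_norm, ← ENNReal.ofReal_mul hC]
  exact ENNReal.ofReal_le_ofReal (h _)

/-- Orthonormal vectors lie at distance `√2 ≥ 1`, so the balls of radius `1/2` around them are
disjoint. Countability later permits exchanging a basis sum with an integral. -/
theorem Orthonormal.countable_of_separableSpace {E ι : Type*} [NormedAddCommGroup E]
    [InnerProductSpace ℂ E] [TopologicalSpace.SeparableSpace E] {v : ι → E}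
    (hv : Orthonormal ℂ v) : Countable ι := by
  refine Pairwise.countable_of_isOpen_disjoint (s := fun i => Metric.ball (v i) (1 / 2))
    (fun i j hij => Metric.ball_disjoint_ball ?_) (fun i => Metric.isOpen_ball)
    fun i => ⟨v i, Metric.mem_ball_self (by norm_num)⟩
  have h := norm_sub_sq (𝕜 := ℂ) (v i) (v j)
  rw [hv.1, hv.1, hv.2 hij] at h
  rw [dist_eq_norm]
  simp only [map_zero] at h
  nlinarith [norm_nonneg (v i - v j)]

theorem enorm_sq_eq_lintegral {α : Type*} [MeasurableSpace α] {μ : Measure α} (f : Lp ℂ 2 μ) :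
    ‖f‖ₑ ^ 2 = ∫⁻ x, ‖f x‖ₑ ^ 2 ∂μ := by
  rw [Lp.enorm_def, eLpNorm_eq_lintegral_rpow_enorm_toReal (by norm_num) (by norm_num)]
  rw [← ENNReal.rpow_natCast, ← ENNReal.rpow_mul]
  norm_num

theorem memLp_two_iff_lintegral {α : Type*} [MeasurableSpace α] {μ : Measure α} {f : α → ℂ}
    (hf : AEStronglyMeasurable f μ) : MemLp f 2 μ ↔ ∫⁻ x, ‖f x‖ₑ ^ 2 ∂μ < ⊤ := by
  rw [MemLp, and_iff_right hf,
    eLpNorm_lt_top_iff_lintegral_rpow_enorm_lt_top (by norm_num) (by norm_num)]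
  norm_num

/-- Cauchy–Schwarz in `[0, ∞]`: without integrability the integral is `0` by convention and the
bound still holds. -/
theorem enorm_integral_mul_sq_le {α : Type*} [MeasurableSpace α] {μ : Measure α} {f g : α → ℂ}
    (hf : AEStronglyMeasurable f μ) (hg : AEStronglyMeasurable g μ) :
    ‖∫ x, f x * g x ∂μ‖ₑ ^ 2 ≤ (∫⁻ x, ‖f x‖ₑ ^ 2 ∂μ) * ∫⁻ x, ‖g x‖ₑ ^ 2 ∂μ := by
  have h1 : ‖∫ x, f x * g x ∂μ‖ₑ ≤ ∫⁻ x, ‖f x‖ₑ * ‖g x‖ₑ ∂μ :=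
    (enorm_integral_le_lintegral_enorm _).trans (by simp)
  have h2 := ENNReal.lintegral_mul_le_Lp_mul_Lq μ (Real.HolderConjugate.two_two) hf.enorm hg.enorm
  have h3 := pow_le_pow_left' (h1.trans h2) 2
  rw [mul_pow] at h3
  simp only [← ENNReal.rpow_natCast, ← ENNReal.rpow_mul] at h3 ⊢
  norm_num at h3 ⊢
  exact h3

/-! ### Integral operators with square-integrable kernel -/

section Kernel

variable {α : Type*} [MeasurableSpace α] {μ : Measure α} [SFinite μ]

/-- Cauchy–Schwarz on each fibre `k (x, ·)`, then Tonelli in `x`. -/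
theorem memLp_integral_kernel {k : α × α → ℂ} (hk : MemLp k 2 (μ.prod μ)) (f : Lp ℂ 2 μ) :
    MemLp (fun x => ∫ y, k (x, y) * f y ∂μ) 2 μ ∧
      ∫⁻ x, ‖∫ y, k (x, y) * f y ∂μ‖ₑ ^ 2 ∂μ ≤
        (∫⁻ z, ‖k z‖ₑ ^ 2 ∂(μ.prod μ)) * ‖f‖ₑ ^ 2 := by
  have hm : AEStronglyMeasurable (fun x => ∫ y, k (x, y) * f y ∂μ) μ :=
    AEStronglyMeasurable.integral_prod_right'
      (f := fun z : α × α => k z * f z.2) (hk.1.mul (Lp.aestronglyMeasurable f).comp_snd)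
  have hb : ∫⁻ x, ‖∫ y, k (x, y) * f y ∂μ‖ₑ ^ 2 ∂μ ≤
      (∫⁻ z, ‖k z‖ₑ ^ 2 ∂(μ.prod μ)) * ‖f‖ₑ ^ 2 := by
    rw [lintegral_prod _ (hk.1.enorm.pow_const 2), ← lintegral_mul_const'' _
      (hk.1.enorm.pow_const 2).lintegral_prod_right', enorm_sq_eq_lintegral]
    refine lintegral_mono_ae ?_
    filter_upwards [hk.1.prodMk_left] with x hx
    exact enorm_integral_mul_sq_le hx (Lp.aestronglyMeasurable f)
  refine ⟨(memLp_two_iff_lintegral hm).2 (hb.trans_lt ?_), hb⟩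
  exact ENNReal.mul_lt_top ((memLp_two_iff_lintegral hk.1).1 hk) (by simp)

theorem ae_memLp_kernel {k : α × α → ℂ} (hk : MemLp k 2 (μ.prod μ)) :
    ∀ᵐ x ∂μ, MemLp (fun y => k (x, y)) 2 μ := by
  have h := (memLp_two_iff_lintegral hk.1).1 hk
  rw [lintegral_prod _ (hk.1.enorm.pow_const 2)] at h
  filter_upwards [hk.1.prodMk_left,
    ae_lt_top' (hk.1.enorm.pow_const 2).lintegral_prod_right' h.ne] with x hx hx'
  exact (memLp_two_iff_lintegral hx).2 hx'

theorem exists_kernelOperator {k : α × α → ℂ} (hk : MemLp k 2 (μ.prod μ)) :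
    ∃ T : Lp ℂ 2 μ →L[ℂ] Lp ℂ 2 μ, ∀ f, T f =ᵐ[μ] fun x => ∫ y, k (x, y) * f y ∂μ := by
  -- Additivity of the Bochner integral needs genuine integrability on almost every fibre.
  have hi (f : Lp ℂ 2 μ) : ∀ᵐ x ∂μ, Integrable (fun y => k (x, y) * f y) μ := by
    filter_upwards [ae_memLp_kernel hk] with x hx
    exact hx.integrable_mul (Lp.memLp f)
  refine ⟨LinearMap.mkContinuous
    { toFun := fun f => (memLp_integral_kernel hk f).1.toLp _
      map_add' := fun f g => ?_
      map_smul' := fun c f => ?_ }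
    (∫⁻ z, ‖k z‖ₑ ^ 2 ∂(μ.prod μ)).toReal.sqrt fun f => ?_,
    fun f => (memLp_integral_kernel hk f).1.coeFn_toLp⟩
  · refine Lp.ext ?_
    filter_upwards [MemLp.coeFn_toLp (memLp_integral_kernel hk (f + g)).1,
      MemLp.coeFn_toLp (memLp_integral_kernel hk f).1,
      MemLp.coeFn_toLp (memLp_integral_kernel hk g).1, hi f, hi g,
      Lp.coeFn_add ((memLp_integral_kernel hk f).1.toLp _)
        ((memLp_integral_kernel hk g).1.toLp _)] with x h1 h2 h3 h4 h5 h6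
    rw [h1, h6, Pi.add_apply, h2, h3, ← integral_add h4 h5]
    refine integral_congr_ae ?_
    filter_upwards [Lp.coeFn_add f g] with y hy
    rw [hy, Pi.add_apply, mul_add]
  · refine Lp.ext ?_
    filter_upwards [MemLp.coeFn_toLp (memLp_integral_kernel hk (c • f)).1,
      MemLp.coeFn_toLp (memLp_integral_kernel hk f).1,
      Lp.coeFn_smul c ((memLp_integral_kernel hk f).1.toLp _)] with x h1 h2 h3
    rw [h1, RingHom.id_apply, h3, Pi.smul_apply, h2, smul_eq_mul, ← integral_const_mul]
    refine integral_congr_ae ?_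
    filter_upwards [Lp.coeFn_smul c f] with y hy
    rw [hy, Pi.smul_apply, smul_eq_mul]
    ring
  · have h := (memLp_integral_kernel hk f).2
    have hn : ‖(memLp_integral_kernel hk f).1.toLp _‖ₑ ^ 2 ≤
        (∫⁻ z, ‖k z‖ₑ ^ 2 ∂(μ.prod μ)) * ‖f‖ₑ ^ 2 := by
      rw [enorm_sq_eq_lintegral]
      refine le_trans (le_of_eq (lintegral_congr_ae ?_)) h
      filter_upwards [MemLp.coeFn_toLp (memLp_integral_kernel hk f).1] with x hx
      rw [hx]
    have hfin := (memLp_two_iff_lintegral hk.1).1 hk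
    have hn' := ENNReal.toReal_mono (ENNReal.mul_lt_top hfin (by simp)).ne hn
    rw [ENNReal.toReal_mul, ENNReal.toReal_pow, ENNReal.toReal_pow, toReal_enorm,
      toReal_enorm] at hn'
    refine le_of_sq_le_sq (hn'.trans_eq ?_) (by positivity)
    rw [mul_pow, Real.sq_sqrt ENNReal.toReal_nonneg]

/-- For almost every `x`, the values `(T bᵢ)(x)` are the coefficients of the conjugated fibre of `k`
in the basis `b`. Parseval sums their squares to the squared norm of the fibre, and Tonelli
integrates over `x`. -/
theorem hsNormSq_kernelOperator [TopologicalSpace.SeparableSpace (Lp ℂ 2 μ)] {k : α × α → ℂ}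
    (hk : MemLp k 2 (μ.prod μ)) {T : Lp ℂ 2 μ →L[ℂ] Lp ℂ 2 μ}
    (hT : ∀ f, T f =ᵐ[μ] fun x => ∫ y, k (x, y) * f y ∂μ) :
    hsNormSq T = ∫⁻ z, ‖k z‖ₑ ^ 2 ∂(μ.prod μ) := by
  obtain ⟨s, b, -⟩ := exists_hilbertBasis ℂ (Lp ℂ 2 μ)
  have : Countable s := b.orthonormal.countable_of_separableSpace
  have hi (i : s) : ‖T (b i)‖ₑ ^ 2 = ∫⁻ x, ‖∫ y, k (x, y) * b i y ∂μ‖ₑ ^ 2 ∂μ := by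
    rw [enorm_sq_eq_lintegral]
    refine lintegral_congr_ae ?_
    filter_upwards [hT (b i)] with x hx
    rw [hx]
  rw [hsNormSq_eq_tsum b, lintegral_prod _ (hk.1.enorm.pow_const 2)]
  simp_rw [hi]
  rw [← lintegral_tsum fun i => (memLp_integral_kernel hk (b i)).1.1.enorm.pow_const 2]
  refine lintegral_congr_ae ?_
  filter_upwards [ae_memLp_kernel hk] with x hx
  have h1 := b.tsum_enorm_inner_sq (hx.star.toLp _)
  rw [enorm_sq_eq_lintegral] at h1
  have h2 : ∫⁻ y, ‖(hx.star.toLp _ : Lp ℂ 2 μ) y‖ₑ ^ 2 ∂μ = ∫⁻ y, ‖k (x, y)‖ₑ ^ 2 ∂μ := by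
    refine lintegral_congr_ae ?_
    filter_upwards [hx.star.coeFn_toLp] with y hy
    rw [hy, Pi.star_apply, RCLike.star_def, RCLike.enorm_conj]
  rw [← h2, ← h1]
  refine tsum_congr fun i => ?_
  congr 1
  rw [← RCLike.enorm_conj (inner ℂ _ _), inner_conj_symm, L2.inner_def]
  congr 1
  refine integral_congr_ae ?_
  filter_upwards [hx.star.coeFn_toLp] with y hy
  rw [hy, RCLike.inner_apply]
  simp [mul_comm]

end Kernel

/-! ### Duality between `L²` and Schwartz functions -/

theorem norm_star_L2 (f : L2R) : ‖star f‖ = ‖f‖ := by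
  rw [Lp.norm_def, Lp.norm_def]
  congr 1
  refine eLpNorm_congr_norm_ae ?_
  filter_upwards [Lp.coeFn_star f] with x hx
  rw [hx, Pi.star_apply, norm_star]

/-- The `L²` norm is determined by the bilinear pairing with Schwartz functions. -/
theorem norm_le_of_integral_schwartz_mul_le (f : L2R) {K : ℝ} (hK : 0 ≤ K)
    (h : ∀ θ : 𝓢(ℝ, ℂ), ‖∫ x, θ x * f x‖ ≤ K * ‖θ.toLp 2‖) : ‖f‖ ≤ K := by
  have key : ∀ g : L2R, ‖inner ℂ (star f) g‖ ≤ K * ‖g‖ := by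
    intro g
    refine (SchwartzMap.denseRange_toLpCLM (E := ℝ) (F := ℂ) (p := 2) (μ := volume)
      ENNReal.ofNat_ne_top).induction_on (p := fun g : L2R => ‖inner ℂ (star f) g‖ ≤ K * ‖g‖) g
      (isClosed_le (by fun_prop) (by fun_prop)) fun θ => ?_
    rw [SchwartzMap.toLpCLM_apply]
    convert h θ using 2
    rw [L2.inner_def]
    refine integral_congr_ae ?_
    filter_upwards [Lp.coeFn_star f, θ.coeFn_toLp 2] with x h1 h2
    rw [h1, h2, RCLike.inner_apply]
    simp
  have h1 := key (star f)
  rw [inner_self_eq_norm_sq_to_K, norm_star_L2, norm_pow, RCLike.norm_ofReal, abs_norm] at h1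
  nlinarith [norm_nonneg f]

/-- Riesz representation for functionals on Schwartz functions that are bounded in `L²`. -/
theorem exists_L2_of_norm_le (ℓ : 𝓢(ℝ, ℂ) →ₗ[ℂ] ℂ) {K : ℝ}
    (h : ∀ θ : 𝓢(ℝ, ℂ), ‖ℓ θ‖ ≤ K * ‖θ.toLp 2‖) : ∃ f : L2R, ∀ θ, ℓ θ = ∫ x, θ x * f x := by
  have hd := SchwartzMap.denseRange_toLpCLM (E := ℝ) (F := ℂ) (p := 2) (μ := volume)
      ENNReal.ofNat_ne_top
  set L : L2R →L[ℂ] ℂ :=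
    ℓ.extendOfNorm (SchwartzMap.toLpCLM ℂ (E := ℝ) ℂ 2 volume).toLinearMap
  have hL (θ : 𝓢(ℝ, ℂ)) : L (θ.toLp 2) = ℓ θ :=
    LinearMap.extendOfNorm_eq (f := ℓ)
      (e := (SchwartzMap.toLpCLM ℂ (E := ℝ) ℂ 2 volume).toLinearMap) hd ⟨K, h⟩ θ
  -- The conjugate converts the sesquilinear Riesz pairing into the bilinear one.
  refine ⟨star ((InnerProductSpace.toDual ℂ L2R).symm L), fun θ => ?_⟩
  rw [← hL, ← InnerProductSpace.toDual_symm_apply, L2.inner_def]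
  refine integral_congr_ae ?_
  filter_upwards [Lp.coeFn_star ((InnerProductSpace.toDual ℂ L2R).symm L),
    θ.coeFn_toLp 2] with x h1 h2
  rw [h1, h2, RCLike.inner_apply]
  simp

/-! ### The symbol and the correlation of two Lorentzians -/

theorem norm_freeSymbol_sq {κ : ℝ} (hκ : 0 < κ) (ξ : ℝ) :
    ‖freeSymbol κ ξ‖ ^ 2 = ((2 * Real.pi * ξ) ^ 2 + κ ^ 2)⁻¹ := by
  have h : 0 < (2 * Real.pi * ξ) ^ 2 + κ ^ 2 := by positivity
  rw [freeSymbol, Complex.norm_real, Real.norm_eq_abs, sq_abs, ← Real.rpow_natCast,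
    ← Real.rpow_mul h.le]
  norm_num [Real.rpow_neg_one]

theorem enorm_freeSymbol_sq {κ : ℝ} (hκ : 0 < κ) (ξ : ℝ) :
    ‖freeSymbol κ ξ‖ₑ ^ 2 = ENNReal.ofReal ((2 * Real.pi * ξ) ^ 2 + κ ^ 2)⁻¹ := by
  rw [← norm_freeSymbol_sq hκ, ENNReal.ofReal_pow (norm_nonneg _), ofReal_norm]

theorem freeSymbol_ne_zero {κ : ℝ} (hκ : 0 < κ) (ξ : ℝ) : freeSymbol κ ξ ≠ 0 := by
  intro h
  have := freeSymbol_mul_self hκ ξ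
  simp [h] at this

theorem continuous_freeSymbol {κ : ℝ} (hκ : 0 < κ) : Continuous (freeSymbol κ) :=
  (freeSymbol_hasTemperateGrowth hκ).1.continuous

/-- The antiderivative given by partial fractions; the coefficient `s⁻¹` of the logarithms is why `s
≠ 0` is required. -/
theorem hasDerivAt_log_arctan {κ s : ℝ} (hκ : 0 < κ) (hs : s ≠ 0) (x : ℝ) :
    HasDerivAt (fun x => (s ^ 2 + 4 * κ ^ 2)⁻¹ *
      (s⁻¹ * (Real.log ((x + s) ^ 2 + κ ^ 2) - Real.log (x ^ 2 + κ ^ 2)) +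
        κ⁻¹ * (Real.arctan (x / κ) + Real.arctan ((x + s) / κ))))
      (((x + s) ^ 2 + κ ^ 2)⁻¹ * (x ^ 2 + κ ^ 2)⁻¹) x := by
  have h1 : 0 < (x + s) ^ 2 + κ ^ 2 := by positivity
  have h2 : 0 < x ^ 2 + κ ^ 2 := by positivity
  have d1 : HasDerivAt (fun x => (x + s) ^ 2 + κ ^ 2) (2 * (x + s)) x := by
    simpa using (((hasDerivAt_id x).add_const s).pow 2).add_const (κ ^ 2)
  have d2 : HasDerivAt (fun x => x ^ 2 + κ ^ 2) (2 * x) x := by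
    simpa using ((hasDerivAt_id x).pow 2).add_const (κ ^ 2)
  have d3 : HasDerivAt (fun x => x / κ) (1 / κ) x := (hasDerivAt_id x).div_const κ
  have d4 : HasDerivAt (fun x => (x + s) / κ) (1 / κ) x :=
    ((hasDerivAt_id x).add_const s).div_const κ
  have h := ((((d1.log h1.ne').sub (d2.log h2.ne')).const_mul s⁻¹).add
    ((d3.arctan.add d4.arctan).const_mul κ⁻¹)).const_mul (s ^ 2 + 4 * κ ^ 2)⁻¹
  refine h.congr_deriv ?_
  have h3 : 1 + (x / κ) ^ 2 = (x ^ 2 + κ ^ 2) / κ ^ 2 := by field_simp; ring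
  have h4 : 1 + ((x + s) / κ) ^ 2 = ((x + s) ^ 2 + κ ^ 2) / κ ^ 2 := by field_simp; ring
  have h5 : 0 < s ^ 2 + 4 * κ ^ 2 := by positivity
  rw [h3, h4]
  field_simp
  ring

theorem integrable_inv_sq_add_sq {κ : ℝ} (hκ : 0 < κ) :
    Integrable (fun x : ℝ => (x ^ 2 + κ ^ 2)⁻¹) := by
  have := (integrable_inv_one_add_sq.comp_div hκ.ne').const_mul (κ ^ 2)⁻¹
  refine this.congr (Eventually.of_forall fun x => ?_)
  have h2 : 0 < x ^ 2 + κ ^ 2 := by positivity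
  have h3 : 1 + (x / κ) ^ 2 = (x ^ 2 + κ ^ 2) / κ ^ 2 := by field_simp; ring
  simp only
  rw [h3]
  field_simp

theorem integrable_inv_mul_inv {κ : ℝ} (hκ : 0 < κ) (s : ℝ) :
    Integrable (fun x : ℝ => ((x + s) ^ 2 + κ ^ 2)⁻¹ * (x ^ 2 + κ ^ 2)⁻¹) := by
  refine (integrable_inv_sq_add_sq hκ).bdd_mul (c := (κ ^ 2)⁻¹) ?_ (Eventually.of_forall fun x => ?_)
  · refine Continuous.aestronglyMeasurable ?_
    exact Continuous.inv₀ (by fun_prop) fun x => by positivity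
  · rw [Real.norm_of_nonneg (by positivity)]
    exact inv_anti₀ (by positivity) (by nlinarith [sq_nonneg (x + s)])

/-- The quotient of the two quadratics tends to `1`. Only `x⁻¹ → 0` matters, so one statement serves
both ends of the line. -/
theorem tendsto_log_sub_log {κ s : ℝ} (hκ : 0 < κ) {l : Filter ℝ}
    (hl : Tendsto (fun x : ℝ => x⁻¹) l (𝓝 0)) (hl' : ∀ᶠ x in l, x ≠ 0) :
    Tendsto (fun x => Real.log ((x + s) ^ 2 + κ ^ 2) - Real.log (x ^ 2 + κ ^ 2)) l (𝓝 0) := by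
  have h1 : Tendsto (fun x => ((1 + s * x⁻¹) ^ 2 + κ ^ 2 * x⁻¹ ^ 2) / (1 + κ ^ 2 * x⁻¹ ^ 2)) l
      (𝓝 (((1 + s * 0) ^ 2 + κ ^ 2 * 0 ^ 2) / (1 + κ ^ 2 * 0 ^ 2))) := by
    refine Tendsto.div ?_ ?_ (by norm_num)
    · exact ((tendsto_const_nhds.add (tendsto_const_nhds.mul hl)).pow 2).add
        (tendsto_const_nhds.mul (hl.pow 2))
    · exact tendsto_const_nhds.add (tendsto_const_nhds.mul (hl.pow 2))
  have h2 := (Real.continuousAt_log (x := ((1 + s * 0) ^ 2 + κ ^ 2 * 0 ^ 2) /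
    (1 + κ ^ 2 * 0 ^ 2)) (by norm_num)).tendsto.comp h1
  norm_num at h2
  refine h2.congr' ?_
  filter_upwards [hl'] with x hx
  have h3 : 0 < (x + s) ^ 2 + κ ^ 2 := by positivity
  have h4 : 0 < x ^ 2 + κ ^ 2 := by positivity
  rw [← Real.log_div h3.ne' h4.ne']
  simp only [Function.comp]
  congr 1
  field_simp

/-- The logarithms cancel at `±∞`, and each of the two arctangents contributes `π`. -/
theorem integral_inv_mul_inv {κ s : ℝ} (hκ : 0 < κ) (hs : s ≠ 0) :
    ∫ x : ℝ, ((x + s) ^ 2 + κ ^ 2)⁻¹ * (x ^ 2 + κ ^ 2)⁻¹ =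
      (s ^ 2 + 4 * κ ^ 2)⁻¹ * (2 * Real.pi / κ) := by
  have ht : Tendsto (fun x : ℝ => x / κ) atTop atTop := tendsto_id.atTop_div_const hκ
  have hb : Tendsto (fun x : ℝ => x / κ) atBot atBot := tendsto_id.atBot_div_const hκ
  have ht' : Tendsto (fun x : ℝ => (x + s) / κ) atTop atTop :=
    (tendsto_atTop_add_const_right _ s tendsto_id).atTop_div_const hκ
  have hb' : Tendsto (fun x : ℝ => (x + s) / κ) atBot atBot :=
    (tendsto_atBot_add_const_right _ s tendsto_id).atBot_div_const hκ
  have at1 := Real.tendsto_arctan_atTop.mono_right nhdsWithin_le_nhds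
  have at2 := Real.tendsto_arctan_atBot.mono_right nhdsWithin_le_nhds
  have l1 := (((tendsto_log_sub_log (s := s) hκ tendsto_inv_atTop_zero
    (eventually_ne_atTop 0)).const_mul s⁻¹).add
      (((at1.comp ht).add (at1.comp ht')).const_mul κ⁻¹)).const_mul (s ^ 2 + 4 * κ ^ 2)⁻¹
  have l2 := (((tendsto_log_sub_log (s := s) hκ tendsto_inv_atBot_zero
    (eventually_ne_atBot 0)).const_mul s⁻¹).add
      (((at2.comp hb).add (at2.comp hb')).const_mul κ⁻¹)).const_mul (s ^ 2 + 4 * κ ^ 2)⁻¹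
  rw [integral_of_hasDerivAt_of_tendsto (hasDerivAt_log_arctan hκ hs)
    (integrable_inv_mul_inv hκ s) l2 l1]
  field_simp
  ring

theorem lintegral_freeSymbol_sq_mul {κ ζ : ℝ} (hκ : 0 < κ) (hζ : ζ ≠ 0) :
    ∫⁻ η : ℝ, ‖freeSymbol κ (ζ + η)‖ₑ ^ 2 * ‖freeSymbol κ η‖ₑ ^ 2 =
      ENNReal.ofReal (1 / κ) * ‖freeSymbol (2 * κ) ζ‖ₑ ^ 2 := by
  have h2π : (2 * Real.pi) ≠ 0 := Real.two_pi_pos.ne'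
  have hi := (integrable_inv_mul_inv hκ (2 * Real.pi * ζ)).comp_mul_left' h2π
  have he : ∫ η : ℝ, ((2 * Real.pi * η + 2 * Real.pi * ζ) ^ 2 + κ ^ 2)⁻¹ *
      ((2 * Real.pi * η) ^ 2 + κ ^ 2)⁻¹ = 1 / κ * ((2 * Real.pi * ζ) ^ 2 + (2 * κ) ^ 2)⁻¹ := by
    rw [Measure.integral_comp_mul_left (fun x : ℝ => ((x + 2 * Real.pi * ζ) ^ 2 + κ ^ 2)⁻¹ *
      (x ^ 2 + κ ^ 2)⁻¹), integral_inv_mul_inv hκ (mul_ne_zero h2π hζ),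
      abs_of_pos (by positivity), smul_eq_mul]
    have h3 : 0 < (2 * Real.pi * ζ) ^ 2 + 4 * κ ^ 2 := by positivity
    have h4 : (2 * Real.pi * ζ) ^ 2 + (2 * κ) ^ 2 = (2 * Real.pi * ζ) ^ 2 + 4 * κ ^ 2 := by ring
    rw [h4]
    field_simp
  rw [enorm_freeSymbol_sq (by positivity), ← ENNReal.ofReal_mul (by positivity), ← he,
    ofReal_integral_eq_lintegral_ofReal hi (Eventually.of_forall fun x => by positivity)]
  refine lintegral_congr fun η => ?_
  rw [enorm_freeSymbol_sq hκ, enorm_freeSymbol_sq hκ, ← ENNReal.ofReal_mul (by positivity)]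
  congr 5
  ring

/-! ### The reciprocal symbol and the `κ`-independent description of `H⁻¹` -/

/-- The reciprocal of `freeSymbol κ`. -/
noncomputable def freeSymbolInv (κ : ℝ) (ξ : ℝ) : ℂ :=
  freeSymbol κ ξ * ((2 * Real.pi * ξ) ^ 2 + κ ^ 2 : ℂ)

theorem freeSymbol_mul_freeSymbolInv {κ : ℝ} (hκ : 0 < κ) (ξ : ℝ) :
    freeSymbol κ ξ * freeSymbolInv κ ξ = 1 := by
  rw [freeSymbolInv, ← mul_assoc, freeSymbol_mul_self hκ]

theorem freeSymbolInv_eq_inv {κ : ℝ} (hκ : 0 < κ) (ξ : ℝ) :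
    freeSymbolInv κ ξ = (freeSymbol κ ξ)⁻¹ :=
  eq_inv_of_mul_eq_one_right (freeSymbol_mul_freeSymbolInv hκ ξ)

theorem norm_freeSymbolInv_sq {κ : ℝ} (hκ : 0 < κ) (ξ : ℝ) :
    ‖freeSymbolInv κ ξ‖ ^ 2 = (2 * Real.pi * ξ) ^ 2 + κ ^ 2 := by
  rw [freeSymbolInv_eq_inv hκ, norm_inv, inv_pow, norm_freeSymbol_sq hκ, inv_inv]

theorem freeSymbolInv_hasTemperateGrowth {κ : ℝ} (hκ : 0 < κ) :
    (freeSymbolInv κ).HasTemperateGrowth :=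
  (freeSymbol_hasTemperateGrowth hκ).mul (by fun_prop)

theorem norm_freeSymbol_le_mul {κ κ' : ℝ} (hκ : 0 < κ) (hκ' : 0 < κ') (ξ : ℝ) :
    ‖freeSymbol κ ξ‖ ≤ √(1 + κ' ^ 2 / κ ^ 2) * ‖freeSymbol κ' ξ‖ := by
  refine le_of_sq_le_sq ?_ (by positivity)
  rw [mul_pow, Real.sq_sqrt (by positivity), norm_freeSymbol_sq hκ, norm_freeSymbol_sq hκ',
    inv_le_iff_one_le_mul₀ (by positivity), mul_right_comm, ← div_eq_mul_inv,
    one_le_div (by positivity)]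
  have : (1 + κ' ^ 2 / κ ^ 2) * ((2 * Real.pi * ξ) ^ 2 + κ ^ 2) =
      (2 * Real.pi * ξ) ^ 2 + κ ^ 2 + κ' ^ 2 + κ' ^ 2 / κ ^ 2 * (2 * Real.pi * ξ) ^ 2 := by
    field_simp
    ring
  rw [this]
  have : 0 ≤ κ' ^ 2 / κ ^ 2 * (2 * Real.pi * ξ) ^ 2 := by positivity
  nlinarith [sq_nonneg κ]

/-- The quotient of the two symbols is a bounded multiplier of temperate growth, and such
multipliers preserve `L²`. -/
theorem exists_L2_freeInvSqrt_of {κ κ' : ℝ} (hκ : 0 < κ) (hκ' : 0 < κ') {V : 𝓢'(ℝ, ℂ)}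
    (h : ∃ f : L2R, freeInvSqrt κ V = (f : 𝓢'(ℝ, ℂ))) :
    ∃ f : L2R, freeInvSqrt κ' V = (f : 𝓢'(ℝ, ℂ)) := by
  rw [← TemperedDistribution.memSobolev_zero_iff] at h ⊢
  have h1 := h.fourierMultiplierCLM_of_bounded (g := freeSymbolInv κ * freeSymbol κ')
    ((freeSymbolInv_hasTemperateGrowth hκ).mul (freeSymbol_hasTemperateGrowth hκ'))
    ⟨√(1 + κ ^ 2 / κ' ^ 2), fun ξ => ?_⟩
  · rw [freeInvSqrt, TemperedDistribution.fourierMultiplierCLM_fourierMultiplierCLM_apply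
      (freeSymbol_hasTemperateGrowth hκ)
      ((freeSymbolInv_hasTemperateGrowth hκ).mul (freeSymbol_hasTemperateGrowth hκ'))] at h1
    have : freeSymbol κ * (freeSymbolInv κ * freeSymbol κ') = freeSymbol κ' := by
      funext ξ
      simp only [Pi.mul_apply]
      rw [← mul_assoc, freeSymbol_mul_freeSymbolInv hκ, one_mul]
    rwa [this] at h1
  · have h2 := norm_freeSymbol_le_mul hκ' hκ ξ
    have h3 : 0 < ‖freeSymbol κ ξ‖ := norm_pos_iff.2 (freeSymbol_ne_zero hκ ξ)
    rw [Pi.mul_apply, freeSymbolInv_eq_inv hκ, norm_mul, norm_inv, mul_comm, ← div_eq_mul_inv,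
      div_le_iff₀ h3]
    exact h2

/-- The value `κ = 2π` is the one for which `(2πξ)² + κ²` is a multiple of `1 + ξ²`. -/
theorem besselPotential_neg_one_eq (V : 𝓢'(ℝ, ℂ)) :
    TemperedDistribution.besselPotential ℝ ℂ (-1) V =
      (2 * Real.pi : ℂ) • freeInvSqrt (2 * Real.pi) V := by
  rw [TemperedDistribution.besselPotential, freeInvSqrt, ← _root_.smul_apply,
    ← TemperedDistribution.fourierMultiplierCLM_smul
      (freeSymbol_hasTemperateGrowth Real.two_pi_pos)]
  congr 2
  funext x
  have h : (2 * Real.pi * x) ^ 2 + (2 * Real.pi) ^ 2 = (2 * Real.pi) ^ 2 * (1 + ‖x‖ ^ 2) := by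
    rw [Real.norm_eq_abs, sq_abs]
    ring
  rw [Pi.smul_apply, freeSymbol, h, Real.mul_rpow (by positivity) (by positivity),
    ← Real.rpow_natCast (2 * Real.pi), ← Real.rpow_mul Real.two_pi_pos.le, smul_eq_mul]
  norm_num [Real.rpow_neg_one]
  have h' : (Real.pi : ℂ) ≠ 0 := by exact_mod_cast Real.pi_ne_zero
  field_simp

theorem memSobolev_neg_one_iff {κ : ℝ} (hκ : 0 < κ) {V : 𝓢'(ℝ, ℂ)} :
    TemperedDistribution.MemSobolev (-1) 2 V ↔
      ∃ f : L2R, freeInvSqrt κ V = (f : 𝓢'(ℝ, ℂ)) := by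
  have h2 : (2 * Real.pi : ℂ) ≠ 0 := by exact_mod_cast Real.two_pi_pos.ne'
  have h : TemperedDistribution.MemSobolev (-1) 2 V ↔
      ∃ f : L2R, freeInvSqrt (2 * Real.pi) V = (f : 𝓢'(ℝ, ℂ)) := by
    rw [TemperedDistribution.MemSobolev, besselPotential_neg_one_eq]
    constructor
    · rintro ⟨f, hf⟩
      refine ⟨(2 * Real.pi : ℂ)⁻¹ • f, ?_⟩
      rw [← Lp.toTemperedDistributionCLM_apply, map_smul, Lp.toTemperedDistributionCLM_apply, ← hf,
        inv_smul_smul₀ h2]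
    · rintro ⟨f, hf⟩
      refine ⟨(2 * Real.pi : ℂ) • f, ?_⟩
      rw [← Lp.toTemperedDistributionCLM_apply, map_smul, Lp.toTemperedDistributionCLM_apply, hf]
  rw [h]
  exact ⟨exists_L2_freeInvSqrt_of Real.two_pi_pos hκ, exists_L2_freeInvSqrt_of hκ Real.two_pi_pos⟩

/-! ### Fourier transforms of `H⁻¹` distributions as functions -/

/-- `w` is the Fourier transform of `V`, in Mathlib's normalization, and lies in the weighted
`L²` space that characterizes `H⁻¹`. -/
structure IsFourierWeight (V : 𝓢'(ℝ, ℂ)) (w : ℝ → ℂ) : Prop where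
  measurable : Measurable w
  memLp : ∀ κ : ℝ, 0 < κ → MemLp (fun ξ => freeSymbol κ ξ * w ξ) 2
  integrable : ∀ φ : 𝓢(ℝ, ℂ), Integrable fun ξ => φ ξ * w ξ
  apply_fourier : ∀ φ : 𝓢(ℝ, ℂ), V (𝓕 φ) = ∫ ξ, φ ξ * w ξ

/-- Divide the symbol out again: if `f` is `(H₀ + 1)^{-1/2} V`, take `w` to be `𝓕 f` times the
reciprocal symbol. This factor has temperate growth, so it can be moved onto test functions. -/
theorem exists_isFourierWeight {V : 𝓢'(ℝ, ℂ)} (hV : TemperedDistribution.MemSobolev (-1) 2 V) :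
    ∃ w, IsFourierWeight V w := by
  obtain ⟨f, hf⟩ := (memSobolev_neg_one_iff one_pos).1 hV
  have hm := freeSymbol_hasTemperateGrowth one_pos
  have hmi := freeSymbolInv_hasTemperateGrowth one_pos
  have hg : TemperedDistribution.smulLeftCLM ℂ (freeSymbol 1) (𝓕 V) =
      ((𝓕 f : L2R) : 𝓢'(ℝ, ℂ)) := by
    rw [← Lp.fourier_toTemperedDistribution_eq, ← hf, freeInvSqrt,
      TemperedDistribution.fourierMultiplierCLM_apply, FourierTransform.fourier_fourierInv_eq]
  set g : L2R := 𝓕 f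
  have hcont : Continuous (freeSymbolInv 1) := hmi.1.continuous
  have hφ (φ : 𝓢(ℝ, ℂ)) (ξ : ℝ) : φ ξ * (freeSymbolInv 1 ξ * g ξ) =
      SchwartzMap.smulLeftCLM ℂ (freeSymbolInv 1) φ ξ * g ξ := by
    rw [SchwartzMap.smulLeftCLM_apply_apply hmi, smul_eq_mul]
    ring
  refine ⟨fun ξ => freeSymbolInv 1 ξ * g ξ, ?_, fun κ hκ => ?_, fun φ => ?_, fun φ => ?_⟩
  · exact hcont.measurable.mul (Lp.stronglyMeasurable g).measurable
  · refine (Lp.memLp g).of_le_mul (c := √(1 + 1 ^ 2 / κ ^ 2)) ?_ (Eventually.of_forall fun ξ => ?_)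
    · exact ((continuous_freeSymbol hκ).aestronglyMeasurable).mul
        (hcont.aestronglyMeasurable.mul (Lp.aestronglyMeasurable g))
    · rw [norm_mul, norm_mul, ← mul_assoc]
      refine mul_le_mul_of_nonneg_right ?_ (norm_nonneg _)
      refine (mul_le_mul_of_nonneg_right (norm_freeSymbol_le_mul hκ one_pos ξ)
        (norm_nonneg _)).trans_eq ?_
      rw [mul_assoc, ← norm_mul, freeSymbol_mul_freeSymbolInv one_pos, norm_one, mul_one]
  · simp_rw [hφ]
    exact (SchwartzMap.memLp _ 2 volume).integrable_mul (Lp.memLp g)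
  · simp_rw [hφ]
    have h1 := congrArg (fun W : 𝓢'(ℝ, ℂ) => W (SchwartzMap.smulLeftCLM ℂ (freeSymbolInv 1) φ)) hg
    simp only [TemperedDistribution.smulLeftCLM_apply_apply,
      Lp.toTemperedDistribution_apply, smul_eq_mul] at h1
    rw [← h1, TemperedDistribution.fourier_apply, SchwartzMap.smulLeftCLM_smulLeftCLM_apply hm hmi]
    have : freeSymbol 1 * freeSymbolInv 1 = fun _ => 1 :=
      funext fun ξ => freeSymbol_mul_freeSymbolInv one_pos ξ
    rw [this, SchwartzMap.smulLeftCLM_const, one_smul]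
    rfl

/-! ### Passage between the two Fourier normalizations -/

/-- The dilation `φ ↦ (2π)^{1/2} φ(2π ·)` intertwines the two normalizations of the Fourier
transform. -/
noncomputable def angularDilation : 𝓢(ℝ, ℂ) →L[ℂ] 𝓢(ℝ, ℂ) :=
  (((2 * Real.pi) ^ (1 / 2 : ℝ) : ℝ) : ℂ) •
    SchwartzMap.compCLMOfContinuousLinearEquiv ℂ
      (ContinuousLinearEquiv.unitsEquivAut ℝ (Units.mk0 (2 * Real.pi) Real.two_pi_pos.ne'))

theorem angularDilation_apply (φ : 𝓢(ℝ, ℂ)) (x : ℝ) :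
    angularDilation φ x = (((2 * Real.pi) ^ (1 / 2 : ℝ) : ℝ) : ℂ) * φ (2 * Real.pi * x) := by
  simp [angularDilation, mul_comm x]

theorem two_pi_rpow_half : (2 * Real.pi) ^ (1 / 2 : ℝ) =
    2 * Real.pi * (2 * Real.pi) ^ (-(1 / 2) : ℝ) := by
  nth_rewrite 2 [← Real.rpow_one (2 * Real.pi)]
  rw [← Real.rpow_add Real.two_pi_pos]
  norm_num

theorem integral_two_pi_mul (F : ℝ → ℂ) :
    (((2 * Real.pi) ^ (1 / 2 : ℝ) : ℝ) : ℂ) * ∫ x, F (2 * Real.pi * x) =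
      (((2 * Real.pi) ^ (-(1 / 2) : ℝ) : ℝ) : ℂ) * ∫ x, F x := by
  rw [Measure.integral_comp_mul_left F, abs_of_pos (by positivity), two_pi_rpow_half,
    Complex.real_smul]
  have h' : (Real.pi : ℂ) ≠ 0 := by exact_mod_cast Real.pi_ne_zero
  push_cast
  field_simp

theorem angularFourier_eq_fourier (φ : 𝓢(ℝ, ℂ)) : angularFourier φ = 𝓕 (angularDilation φ) := by
  ext ξ
  rw [angularFourier_apply, SchwartzMap.fourier_coe, Real.fourier_eq', ← integral_two_pi_mul,
    ← integral_const_mul]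
  refine integral_congr_ae (Eventually.of_forall fun x => ?_)
  simp only [angularDilation_apply, smul_eq_mul, RCLike.inner_apply, conj_trivial]
  rw [mul_left_comm]
  congr 3
  push_cast
  ring

theorem locallyIntegrable_of_integrable_schwartz_mul {v : ℝ → ℂ}
    (h : ∀ φ : 𝓢(ℝ, ℂ), Integrable fun ξ => φ ξ * v ξ) : LocallyIntegrable v := by
  rw [locallyIntegrable_iff]
  intro K hK
  obtain ⟨R, hR⟩ := hK.isBounded.subset_closedBall 0
  -- The maximum with `1` keeps the inner radius positive whatever `R` is.
  let χ : ContDiffBump (0 : ℝ) := ⟨max R 1, max R 1 + 1, by positivity, by linarith⟩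
  have h1 : HasCompactSupport (Complex.ofRealCLM ∘ χ) := χ.hasCompactSupport.comp_left rfl
  have h2 : ContDiff ℝ ((⊤ : ℕ∞) : WithTop ℕ∞) (Complex.ofRealCLM ∘ χ) :=
    Complex.ofRealCLM.contDiff.comp χ.contDiff
  refine (h (h1.toSchwartzMap h2)).integrableOn.congr_fun (fun x hx => ?_) hK.measurableSet
  have h3 : χ x = 1 := χ.one_of_mem_closedBall
    (Metric.closedBall_subset_closedBall (le_max_left _ _) (hR hx))
  simp [h3]

theorem IsFourierWeight.isFourierFunction {V : 𝓢'(ℝ, ℂ)} {w : ℝ → ℂ} (h : IsFourierWeight V w) :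
    IsFourierFunction V fun ξ =>
      (((2 * Real.pi) ^ (-(1 / 2) : ℝ) : ℝ) : ℂ) * w ((2 * Real.pi)⁻¹ * ξ) := by
  have h2π : (2 * Real.pi) ≠ 0 := Real.two_pi_pos.ne'
  have hi (φ : 𝓢(ℝ, ℂ)) : Integrable fun ξ =>
      φ ξ * ((((2 * Real.pi) ^ (-(1 / 2) : ℝ) : ℝ) : ℂ) * w ((2 * Real.pi)⁻¹ * ξ)) := by
    have h1 := ((h.integrable (angularDilation φ)).comp_mul_left'
      (inv_ne_zero h2π)).const_mul ((2 * Real.pi : ℂ)⁻¹)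
    refine h1.congr (Eventually.of_forall fun ξ => ?_)
    simp only [angularDilation_apply, mul_inv_cancel_left₀ h2π, two_pi_rpow_half]
    have h' : (Real.pi : ℂ) ≠ 0 := by exact_mod_cast Real.pi_ne_zero
    push_cast
    field_simp
  refine ⟨locallyIntegrable_of_integrable_schwartz_mul hi, fun φ => ⟨hi φ, ?_⟩⟩
  rw [angularFourier_eq_fourier, h.apply_fourier]
  have h1 := integral_two_pi_mul fun ξ => φ ξ * w ((2 * Real.pi)⁻¹ * ξ)
  rw [← integral_const_mul, ← integral_const_mul] at h1
  convert h1 using 1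
  · refine integral_congr_ae (Eventually.of_forall fun x => ?_)
    simp only [angularDilation_apply, inv_mul_cancel_left₀ h2π]
    ring
  · refine integral_congr_ae (Eventually.of_forall fun x => ?_)
    simp only
    ring

/-- The factor `(2π)⁻¹` from the squared normalization cancels the Jacobian `2π` of the dilation. -/
theorem IsFourierWeight.integrable_angular {V : 𝓢'(ℝ, ℂ)} {w : ℝ → ℂ} (h : IsFourierWeight V w)
    {κ : ℝ} (hκ : 0 < κ) :
    Integrable (fun ξ : ℝ => ‖(((2 * Real.pi) ^ (-(1 / 2) : ℝ) : ℝ) : ℂ) *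
        w ((2 * Real.pi)⁻¹ * ξ)‖ ^ 2 / (ξ ^ 2 + 4 * κ ^ 2)) ∧
      ∫⁻ ξ, ‖freeSymbol (2 * κ) ξ * w ξ‖ₑ ^ 2 =
        ENNReal.ofReal (∫ ξ : ℝ, ‖(((2 * Real.pi) ^ (-(1 / 2) : ℝ) : ℝ) : ℂ) *
          w ((2 * Real.pi)⁻¹ * ξ)‖ ^ 2 / (ξ ^ 2 + 4 * κ ^ 2)) := by
  have h2π : (2 * Real.pi) ≠ 0 := Real.two_pi_pos.ne'
  have hm := h.memLp (2 * κ) (by positivity)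
  have hi := (memLp_two_iff_integrable_sq_norm hm.1).1 hm
  have he (ξ : ℝ) : ‖(((2 * Real.pi) ^ (-(1 / 2) : ℝ) : ℝ) : ℂ) *
      w ((2 * Real.pi)⁻¹ * ξ)‖ ^ 2 / (ξ ^ 2 + 4 * κ ^ 2) = (2 * Real.pi)⁻¹ *
        ‖freeSymbol (2 * κ) ((2 * Real.pi)⁻¹ * ξ) * w ((2 * Real.pi)⁻¹ * ξ)‖ ^ 2 := by
    rw [norm_mul, norm_mul, mul_pow, mul_pow, norm_freeSymbol_sq (by positivity),
      Complex.norm_real, Real.norm_eq_abs, sq_abs, ← Real.rpow_natCast _ 2,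
      ← Real.rpow_mul Real.two_pi_pos.le, mul_inv_cancel_left₀ h2π]
    norm_num [Real.rpow_neg_one]
    rw [mul_pow]
    norm_num
    ring
  simp_rw [he]
  refine ⟨(hi.comp_mul_left' (inv_ne_zero h2π)).const_mul _, ?_⟩
  rw [integral_const_mul, Measure.integral_comp_mul_left
    (fun ξ => ‖freeSymbol (2 * κ) ξ * w ξ‖ ^ 2), inv_inv, abs_of_pos Real.two_pi_pos, smul_eq_mul,
    inv_mul_cancel_left₀ h2π,
    ofReal_integral_eq_lintegral_ofReal hi (Eventually.of_forall fun x => by positivity)]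
  refine lintegral_congr fun ξ => ?_
  rw [ENNReal.ofReal_pow (norm_nonneg _), ofReal_norm]

/-! ### The operator as an integral operator in Fourier space -/

/-- The integral kernel of `(H₀ + κ²)^{-1/2} V (H₀ + κ²)^{-1/2}` in Fourier space, when `𝓕 V` is
the function `w`. -/
noncomputable def sandwichKernel (κ : ℝ) (w : ℝ → ℂ) (z : ℝ × ℝ) : ℂ :=
  freeSymbol κ z.1 * w (z.1 - z.2) * freeSymbol κ z.2

theorem measurable_sandwichKernel {κ : ℝ} (hκ : 0 < κ) {w : ℝ → ℂ} (hw : Measurable w) :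
    Measurable (sandwichKernel κ w) := by
  have h := (continuous_freeSymbol hκ).measurable
  exact ((h.comp measurable_fst).mul (hw.comp (measurable_fst.sub measurable_snd))).mul
    (h.comp measurable_snd)

/-- The measure-preserving shear `(ζ, η) ↦ (ζ + η, η)` separates `w(ζ)` from the two symbols,
leaving a Lorentzian correlation in `η`. -/
theorem lintegral_sandwichKernel {κ : ℝ} (hκ : 0 < κ) {w : ℝ → ℂ} (hw : Measurable w) :
    ∫⁻ z, ‖sandwichKernel κ w z‖ₑ ^ 2 ∂(volume.prod volume) =
      ENNReal.ofReal (1 / κ) * ∫⁻ ξ, ‖freeSymbol (2 * κ) ξ * w ξ‖ₑ ^ 2 := by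
  have hm := (continuous_freeSymbol hκ).measurable
  have h1 := (measurePreserving_add_prod (volume : Measure ℝ) (volume : Measure ℝ)).lintegral_comp
    (f := fun z => ‖sandwichKernel κ w z‖ₑ ^ 2)
    ((measurable_sandwichKernel hκ hw).enorm.pow_const 2)
  have h2 : Measurable fun z : ℝ × ℝ => ‖sandwichKernel κ w (z.1 + z.2, z.2)‖ₑ ^ 2 :=
    ((measurable_sandwichKernel hκ hw).enorm.pow_const 2).comp (by fun_prop)
  rw [← h1, lintegral_prod _ h2.aemeasurable,
    ← lintegral_const_mul' _ _ ENNReal.ofReal_ne_top]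
  refine lintegral_congr_ae ?_
  -- The correlation formula was proved only off the null set `ζ = 0`.
  filter_upwards [Measure.ae_ne volume 0] with ζ hζ
  rw [enorm_mul, mul_pow, ← mul_assoc, ← lintegral_freeSymbol_sq_mul hκ hζ, mul_comm,
    ← lintegral_const_mul]
  · refine lintegral_congr fun η => ?_
    simp only [sandwichKernel, add_sub_cancel_right, enorm_mul, mul_pow]
    ring
  · exact ((hm.comp (measurable_const_add ζ)).enorm.pow_const 2).mul (hm.enorm.pow_const 2)

theorem IsFourierWeight.memLp_sandwichKernel {V : 𝓢'(ℝ, ℂ)} {w : ℝ → ℂ}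
    (h : IsFourierWeight V w) {κ : ℝ} (hκ : 0 < κ) :
    MemLp (sandwichKernel κ w) 2 (volume.prod volume) := by
  rw [memLp_two_iff_lintegral (measurable_sandwichKernel hκ h.measurable).aestronglyMeasurable,
    lintegral_sandwichKernel hκ h.measurable]
  have hm := h.memLp (2 * κ) (by positivity)
  exact ENNReal.mul_lt_top (by simp) ((memLp_two_iff_lintegral hm.1).1 hm)

theorem smulLeftCLM_freeInvSqrt_apply (κ : ℝ) (u : 𝓢(ℝ, ℂ)) (V : 𝓢'(ℝ, ℂ)) (θ : 𝓢(ℝ, ℂ)) :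
    freeInvSqrt κ (TemperedDistribution.smulLeftCLM ℂ u V) θ =
      V (SchwartzMap.smulLeftCLM ℂ u (𝓕 (SchwartzMap.smulLeftCLM ℂ (freeSymbol κ) (𝓕⁻ θ)))) :=
  rfl

/-- A product of two Schwartz functions is the Fourier transform of a correlation. -/
theorem exists_fourier_eq_fourierInv_mul_fourier (a c : 𝓢(ℝ, ℂ)) :
    ∃ ψ : 𝓢(ℝ, ℂ), 𝓕 ψ = SchwartzMap.smulLeftCLM ℂ (𝓕⁻ a : 𝓢(ℝ, ℂ)) (𝓕 c) ∧
      ∀ ζ, ψ ζ = ∫ η, a η * c (ζ + η) := by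
  -- Reflecting `a` turns convolution into correlation and `𝓕` into `𝓕⁻`.
  set a' : 𝓢(ℝ, ℂ) := SchwartzMap.compCLMOfContinuousLinearEquiv ℂ
    (ContinuousLinearEquiv.neg ℝ : ℝ ≃L[ℝ] ℝ) a with ha'
  have ha : 𝓕 a' = 𝓕⁻ a := by
    ext x
    rw [SchwartzMap.fourier_coe, SchwartzMap.fourierInv_coe, Real.fourierInv_eq_fourier_comp_neg]
    rfl
  refine ⟨SchwartzMap.convolution (ContinuousLinearMap.mul ℂ ℂ) a' c, ?_, fun ζ => ?_⟩
  · rw [SchwartzMap.fourier_convolution, ha]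
    ext x
    rw [SchwartzMap.smulLeftCLM_apply_apply (𝓕⁻ a : 𝓢(ℝ, ℂ)).hasTemperateGrowth]
    simp [SchwartzMap.pairing_apply_apply]
  · rw [SchwartzMap.convolution_apply, convolution_def, ← integral_neg_eq_self]
    refine integral_congr_ae (Eventually.of_forall fun x => ?_)
    simp [ha']

/-- The operator is the kernel operator conjugated by the unitary Fourier transform. Pairing with a
test function and using Fubini together with the shear identifies it with the distributional
definition. -/
theorem IsFourierWeight.exists_sandwich {V : 𝓢'(ℝ, ℂ)} {w : ℝ → ℂ}
    (h : IsFourierWeight V w) {κ : ℝ} (hκ : 0 < κ) :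
    ∃ A : L2R →L[ℂ] L2R, IsSandwich κ V A ∧
      hsNormSq A = ENNReal.ofReal (1 / κ) * ∫⁻ ξ, ‖freeSymbol (2 * κ) ξ * w ξ‖ₑ ^ 2 := by
  have hm := freeSymbol_hasTemperateGrowth hκ
  have hk := h.memLp_sandwichKernel hκ
  obtain ⟨T, hT⟩ := exists_kernelOperator hk
  set U : L2R ≃ₗᵢ[ℂ] L2R := Lp.fourierTransformₗᵢ ℝ ℂ with hU
  refine ⟨(U.symm : L2R →L[ℂ] L2R) ∘L T ∘L (U : L2R →L[ℂ] L2R), fun φ => ?_, ?_⟩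
  · ext θ
    have h1 : ((U.symm : L2R →L[ℂ] L2R) ∘L T ∘L (U : L2R →L[ℂ] L2R)) (φ.toLp 2) =
        𝓕⁻ (T ((𝓕 φ).toLp 2)) := by
      rw [← SchwartzMap.toLp_fourier_eq]
      rfl
    rw [h1, ← Lp.fourierInv_toTemperedDistribution_eq, TemperedDistribution.fourierInv_apply,
      Lp.toTemperedDistribution_apply, smulLeftCLM_freeInvSqrt_apply, freeInvSqrtSchwartz,
      SchwartzMap.fourierMultiplierCLM_apply]
    set θ' : 𝓢(ℝ, ℂ) := 𝓕⁻ θ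
    set φ' : 𝓢(ℝ, ℂ) := 𝓕 φ
    set c := SchwartzMap.smulLeftCLM ℂ (freeSymbol κ) θ' with hc
    set a := SchwartzMap.smulLeftCLM ℂ (freeSymbol κ) φ' with ha
    obtain ⟨ψ, hψ, hψ'⟩ := exists_fourier_eq_fourierInv_mul_fourier a c
    rw [← hψ, h.apply_fourier]
    have hF (ξ η : ℝ) : c ξ * a η * w (ξ - η) =
        θ' ξ * (sandwichKernel κ w (ξ, η) * φ' η) := by
      rw [hc, ha, SchwartzMap.smulLeftCLM_apply_apply hm, SchwartzMap.smulLeftCLM_apply_apply hm,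
        sandwichKernel]
      simp only [smul_eq_mul]
      ring
    -- Fubini is justified by writing the integrand as a product of two `L²` functions on the plane:
    -- the kernel and a tensor product of Schwartz functions.
    have hint : Integrable (fun z : ℝ × ℝ => c z.1 * a z.2 * w (z.1 - z.2))
        (volume.prod volume) := by
      simp_rw [hF]
      have hθφ : MemLp (fun z : ℝ × ℝ => θ' z.1 * φ' z.2) 2 (volume.prod volume) := by
        refine (memLp_two_iff_lintegral ?_).2 ?_
        · exact ((θ'.continuous.comp continuous_fst).mul
            (φ'.continuous.comp continuous_snd)).aestronglyMeasurable
        · simp_rw [enorm_mul, mul_pow]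
          rw [lintegral_prod_mul (f := fun x => ‖θ' x‖ₑ ^ 2) (g := fun x => ‖φ' x‖ₑ ^ 2)
            (θ'.continuous.enorm.measurable.pow_const 2).aemeasurable
            (φ'.continuous.enorm.measurable.pow_const 2).aemeasurable]
          exact ENNReal.mul_lt_top
            ((memLp_two_iff_lintegral θ'.continuous.aestronglyMeasurable).1
              (θ'.memLp 2 volume))
            ((memLp_two_iff_lintegral φ'.continuous.aestronglyMeasurable).1
              (φ'.memLp 2 volume))
      refine (hθφ.integrable_mul hk).congr (Eventually.of_forall fun z => ?_)
      simp only [Pi.mul_apply]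
      ring
    have hmp := measurePreserving_add_prod (volume : Measure ℝ) (volume : Measure ℝ)
    have hint' : Integrable (fun z : ℝ × ℝ => c (z.1 + z.2) * a z.2 * w z.1)
        (volume.prod volume) := by
      have := hmp.integrable_comp_of_integrable hint
      simpa [Function.comp_def] using this
    calc ∫ ξ, θ' ξ • T (φ'.toLp 2) ξ
        = ∫ ξ, ∫ η, c ξ * a η * w (ξ - η) := by
          refine integral_congr_ae ?_
          filter_upwards [hT (φ'.toLp 2)] with ξ hξ
          rw [hξ, smul_eq_mul, ← integral_const_mul]
          refine integral_congr_ae ?_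
          filter_upwards [φ'.coeFn_toLp 2] with η hη
          rw [hη, hF]
      _ = ∫ η, ∫ ξ, c ξ * a η * w (ξ - η) := integral_integral_swap hint
      _ = ∫ η, ∫ ζ, c (ζ + η) * a η * w ζ := by
          refine integral_congr_ae (Eventually.of_forall fun η => ?_)
          simp only
          rw [← integral_add_right_eq_self _ η]
          simp only [add_sub_cancel_right]
      _ = ∫ ζ, ∫ η, c (ζ + η) * a η * w ζ := (integral_integral_swap hint').symm
      _ = ∫ ζ, ψ ζ * w ζ := by
          refine integral_congr_ae (Eventually.of_forall fun ζ => ?_)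
          simp only
          rw [hψ', ← integral_mul_const]
          refine integral_congr_ae (Eventually.of_forall fun η => ?_)
          simp only
          ring
  · have : Fact ((2 : ℝ≥0∞) ≠ ⊤) := ⟨ENNReal.ofNat_ne_top⟩
    rw [hsNormSq_conj_isometry, hsNormSq_kernelOperator hk hT,
      lintegral_sandwichKernel hκ h.measurable]

/-! ### Multiplication operators on `H¹` -/

theorem norm_toLp_two_sq (φ : 𝓢(ℝ, ℂ)) : ‖φ.toLp 2‖ ^ 2 = ∫ x, ‖φ x‖ ^ 2 := by
  have h := SchwartzMap.inner_toL2_toL2_eq φ φ volume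
  simp_rw [inner_self_eq_norm_sq_to_K] at h
  have h2 : ∫ x, ((‖φ x‖ : ℂ)) ^ 2 = ((∫ x, ‖φ x‖ ^ 2 : ℝ) : ℂ) := by
    rw [← integral_complex_ofReal]
    simp
  apply Complex.ofReal_injective
  rw [Complex.ofReal_pow]
  exact h.trans h2

theorem integrable_norm_sq (φ : 𝓢(ℝ, ℂ)) : Integrable fun x => ‖φ x‖ ^ 2 :=
  (memLp_two_iff_integrable_sq_norm φ.continuous.aestronglyMeasurable).1 (φ.memLp 2 volume)

theorem norm_toLp_fourierInv (φ : 𝓢(ℝ, ℂ)) : ‖(𝓕⁻ φ : 𝓢(ℝ, ℂ)).toLp 2‖ = ‖φ.toLp 2‖ := by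
  rw [← SchwartzMap.norm_fourier_toL2_eq, FourierTransform.fourier_fourierInv_eq]

/-- The multiplier `σ` applied with the inverse Fourier transform; this is the transpose of
`TemperedDistribution.fourierMultiplierCLM`. -/
noncomputable def transposeMultiplier (σ : ℝ → ℂ) : 𝓢(ℝ, ℂ) →L[ℂ] 𝓢(ℝ, ℂ) :=
  FourierTransform.fourierCLM ℂ 𝓢(ℝ, ℂ) ∘L SchwartzMap.smulLeftCLM ℂ σ ∘L
    FourierTransform.fourierInvCLM ℂ 𝓢(ℝ, ℂ)

theorem transposeMultiplier_apply (σ : ℝ → ℂ) (φ : 𝓢(ℝ, ℂ)) :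
    transposeMultiplier σ φ = 𝓕 (SchwartzMap.smulLeftCLM ℂ σ (𝓕⁻ φ)) := rfl

theorem transposeMultiplier_inv_apply {κ : ℝ} (hκ : 0 < κ) (φ : 𝓢(ℝ, ℂ)) :
    transposeMultiplier (freeSymbol κ) (transposeMultiplier (freeSymbolInv κ) φ) = φ ∧
      transposeMultiplier (freeSymbolInv κ) (transposeMultiplier (freeSymbol κ) φ) = φ := by
  have hm := freeSymbol_hasTemperateGrowth hκ
  have hmi := freeSymbolInv_hasTemperateGrowth hκ
  have h1 : freeSymbol κ * freeSymbolInv κ = fun _ => 1 :=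
    funext fun ξ => freeSymbol_mul_freeSymbolInv hκ ξ
  have h2 : freeSymbolInv κ * freeSymbol κ = fun _ => 1 := by rw [mul_comm, h1]
  constructor
  · simp only [transposeMultiplier_apply, FourierTransform.fourierInv_fourier_eq]
    rw [SchwartzMap.smulLeftCLM_smulLeftCLM_apply hm hmi, h1]
    simp
  · simp only [transposeMultiplier_apply, FourierTransform.fourierInv_fourier_eq]
    rw [SchwartzMap.smulLeftCLM_smulLeftCLM_apply hmi hm, h2]
    simp

/-- Plancherel, since the reciprocal symbol has squared modulus `(2πξ)² + κ²`. This makes the norm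
computable by the product rule. -/
theorem norm_transposeMultiplier_inv_sq {κ : ℝ} (hκ : 0 < κ) (y : 𝓢(ℝ, ℂ)) :
    ‖(transposeMultiplier (freeSymbolInv κ) y).toLp 2‖ ^ 2 =
      (∫ x, ‖deriv y x‖ ^ 2) + κ ^ 2 * ∫ x, ‖y x‖ ^ 2 := by
  have hmi := freeSymbolInv_hasTemperateGrowth hκ
  set y' : 𝓢(ℝ, ℂ) := LineDeriv.lineDerivOp (1 : ℝ) y with hy'
  have h1 (x : ℝ) : deriv y x = y' x := by
    rw [hy', SchwartzMap.lineDerivOp_apply_eq_fderiv, fderiv_apply_one_eq_deriv]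
  have h2 (ξ : ℝ) : ‖(𝓕⁻ y' : 𝓢(ℝ, ℂ)) ξ‖ ^ 2 =
      (2 * Real.pi * ξ) ^ 2 * ‖(𝓕⁻ y : 𝓢(ℝ, ℂ)) ξ‖ ^ 2 := by
    have hg : (fun x : ℝ => inner ℝ x (1 : ℝ)).HasTemperateGrowth := by fun_prop
    rw [hy', SchwartzMap.fourierInv_lineDerivOp_eq, _root_.smul_apply,
      SchwartzMap.smulLeftCLM_apply_apply hg]
    simp [mul_pow, abs_of_pos Real.pi_pos]
    ring
  simp_rw [h1]
  rw [transposeMultiplier_apply, SchwartzMap.norm_fourier_toL2_eq, norm_toLp_two_sq,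
    ← norm_toLp_two_sq, ← norm_toLp_two_sq y', ← norm_toLp_fourierInv y', norm_toLp_two_sq,
    ← norm_toLp_two_sq y, ← norm_toLp_fourierInv y, norm_toLp_two_sq, norm_toLp_two_sq,
    ← integral_const_mul, ← integral_add (integrable_norm_sq _)
      ((integrable_norm_sq _).const_mul _)]
  refine integral_congr_ae (Eventually.of_forall fun ξ => ?_)
  simp only
  rw [SchwartzMap.smulLeftCLM_apply_apply hmi, norm_smul, mul_pow, norm_freeSymbolInv_sq hκ, h2]
  ring

/-- Multiplication by a `C¹`-bounded Schwartz function is bounded on the Sobolev space `H¹`. -/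
theorem norm_transposeMultiplier_smul_le {κ : ℝ} (hκ : 0 < κ) {g : 𝓢(ℝ, ℂ)} {M : ℝ}
    (h0 : ∀ x, ‖g x‖ ≤ 1) (h1 : ∀ x, ‖deriv g x‖ ≤ M) (θ : 𝓢(ℝ, ℂ)) :
    ‖(transposeMultiplier (freeSymbolInv κ) (SchwartzMap.smulLeftCLM ℂ g
      (transposeMultiplier (freeSymbol κ) θ))).toLp 2‖ ≤ √(2 + 2 * M ^ 2 / κ ^ 2) * ‖θ.toLp 2‖ := by
  set u := transposeMultiplier (freeSymbol κ) θ with hu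
  have hθ : θ = transposeMultiplier (freeSymbolInv κ) u := (transposeMultiplier_inv_apply hκ θ).2.symm
  have hgu (x : ℝ) : SchwartzMap.smulLeftCLM ℂ g u x = g x * u x :=
    SchwartzMap.smulLeftCLM_apply_apply g.hasTemperateGrowth u x
  have hd (x : ℝ) : deriv (SchwartzMap.smulLeftCLM ℂ g u) x = deriv g x * u x + g x * deriv u x := by
    have : ⇑(SchwartzMap.smulLeftCLM ℂ g u) = fun x => g x * u x := funext hgu
    rw [this]
    exact ((g.hasDerivAt x).mul (u.hasDerivAt x)).deriv
  have iu := integrable_norm_sq u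
  have iu' : Integrable fun x => ‖deriv u x‖ ^ 2 := integrable_norm_sq (SchwartzMap.derivCLM ℂ ℂ u)
  have b0 : ∫ x, ‖SchwartzMap.smulLeftCLM ℂ g u x‖ ^ 2 ≤ ∫ x, ‖u x‖ ^ 2 := by
    refine integral_mono (integrable_norm_sq _) iu fun x => ?_
    simp only [hgu, norm_mul, mul_pow]
    have : ‖g x‖ ^ 2 ≤ 1 := pow_le_one₀ (norm_nonneg _) (h0 x)
    nlinarith [sq_nonneg ‖u x‖]
  have b1 : ∫ x, ‖deriv (SchwartzMap.smulLeftCLM ℂ g u) x‖ ^ 2 ≤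
      2 * M ^ 2 * (∫ x, ‖u x‖ ^ 2) + 2 * ∫ x, ‖deriv u x‖ ^ 2 := by
    rw [← integral_const_mul, ← integral_const_mul,
      ← integral_add (iu.const_mul _) (iu'.const_mul _)]
    refine integral_mono (integrable_norm_sq (SchwartzMap.derivCLM ℂ ℂ _))
      ((iu.const_mul _).add (iu'.const_mul _)) fun x => ?_
    simp only [hd]
    have e1 : ‖deriv g x * u x + g x * deriv u x‖ ≤ M * ‖u x‖ + ‖deriv u x‖ := by
      refine (norm_add_le _ _).trans (add_le_add ?_ ?_)
      · rw [norm_mul]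
        exact mul_le_mul_of_nonneg_right (h1 x) (norm_nonneg _)
      · rw [norm_mul]
        exact mul_le_of_le_one_left (norm_nonneg _) (h0 x)
    have e2 := pow_le_pow_left₀ (norm_nonneg _) e1 2
    nlinarith [sq_nonneg (M * ‖u x‖ - ‖deriv u x‖)]
  refine le_of_sq_le_sq ?_ (by positivity)
  rw [mul_pow, Real.sq_sqrt (by positivity), hθ, norm_transposeMultiplier_inv_sq hκ,
    norm_transposeMultiplier_inv_sq hκ]
  have p0 : 0 ≤ ∫ x, ‖u x‖ ^ 2 := integral_nonneg fun x => by positivity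
  have p1 : 0 ≤ ∫ x, ‖deriv u x‖ ^ 2 := integral_nonneg fun x => by positivity
  -- The constant is chosen to dominate both coefficients left by `b0` and `b1`: `2` on `‖u'‖²` and
  -- `2M² + κ²` on `‖u‖²`.
  have e : (2 + 2 * M ^ 2 / κ ^ 2) * ((∫ x, ‖deriv u x‖ ^ 2) + κ ^ 2 * ∫ x, ‖u x‖ ^ 2) =
      2 * (∫ x, ‖deriv u x‖ ^ 2) + (2 * κ ^ 2 + 2 * M ^ 2) * (∫ x, ‖u x‖ ^ 2) +
        2 * M ^ 2 / κ ^ 2 * ∫ x, ‖deriv u x‖ ^ 2 := by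
    field_simp
    ring
  rw [e]
  have p2 : 0 ≤ 2 * M ^ 2 / κ ^ 2 * ∫ x, ‖deriv u x‖ ^ 2 := by positivity
  nlinarith [mul_nonneg (sq_nonneg κ) p0, mul_le_mul_of_nonneg_left b0 (sq_nonneg κ)]

/-- Formally `B = (H₀ + κ²)^{-1/2} g (H₀ + κ²)^{1/2} A`. The left factor is handled through its
transpose on Schwartz functions, which the `H¹` estimate bounds. -/
theorem IsSandwich.norm_le_of_smul {κ : ℝ} (hκ : 0 < κ) {V : 𝓢'(ℝ, ℂ)} {g : 𝓢(ℝ, ℂ)} {M : ℝ}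
    (h0 : ∀ x, ‖g x‖ ≤ 1) (h1 : ∀ x, ‖deriv g x‖ ≤ M) {A B : L2R →L[ℂ] L2R}
    (hA : IsSandwich κ V A) (hB : IsSandwich κ (TemperedDistribution.smulLeftCLM ℂ g V) B)
    (f : L2R) : ‖B f‖ ≤ √(2 + 2 * M ^ 2 / κ ^ 2) * ‖A f‖ := by
  refine (SchwartzMap.denseRange_toLpCLM (E := ℝ) (F := ℂ) (p := 2) (μ := volume)
    ENNReal.ofNat_ne_top).induction_on
    (p := fun f : L2R => ‖B f‖ ≤ √(2 + 2 * M ^ 2 / κ ^ 2) * ‖A f‖) f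
    (isClosed_le (by fun_prop) (by fun_prop)) fun φ => ?_
  rw [SchwartzMap.toLpCLM_apply]
  refine norm_le_of_integral_schwartz_mul_le _ (by positivity) fun θ => ?_
  set u := freeInvSqrtSchwartz κ φ
  set y := SchwartzMap.smulLeftCLM ℂ g (transposeMultiplier (freeSymbol κ) θ) with hy
  -- Pairing `B φ` with `θ` equals pairing `A φ` with `θ'`; both reduce to `V` applied to the same
  -- test function.
  set θ' := transposeMultiplier (freeSymbolInv κ) y with hθ'
  have e1 : ∫ x, θ x * B (φ.toLp 2) x = V (SchwartzMap.smulLeftCLM ℂ u y) := by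
    have := congrArg (fun W : 𝓢'(ℝ, ℂ) => W θ) (hB φ)
    simp only [Lp.toTemperedDistribution_apply, smulLeftCLM_freeInvSqrt_apply] at this
    simp only [smul_eq_mul] at this
    rw [this, TemperedDistribution.smulLeftCLM_apply_apply,
      SchwartzMap.smulLeftCLM_smulLeftCLM_apply g.hasTemperateGrowth u.hasTemperateGrowth, hy,
      SchwartzMap.smulLeftCLM_smulLeftCLM_apply u.hasTemperateGrowth g.hasTemperateGrowth,
      mul_comm, transposeMultiplier_apply]
  have e2 : ∫ x, θ' x * A (φ.toLp 2) x = V (SchwartzMap.smulLeftCLM ℂ u y) := by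
    have := congrArg (fun W : 𝓢'(ℝ, ℂ) => W θ') (hA φ)
    simp only [Lp.toTemperedDistribution_apply, smulLeftCLM_freeInvSqrt_apply] at this
    simp only [smul_eq_mul] at this
    rw [this, ← transposeMultiplier_apply, hθ', (transposeMultiplier_inv_apply hκ y).1]
  rw [e1, ← e2]
  have e3 : ∫ x, θ' x * A (φ.toLp 2) x = inner ℂ (star (A (φ.toLp 2))) (θ'.toLp 2) := by
    rw [L2.inner_def]
    refine integral_congr_ae ?_
    filter_upwards [Lp.coeFn_star (A (φ.toLp 2)), θ'.coeFn_toLp 2] with x h1 h2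
    rw [h1, h2, RCLike.inner_apply]
    simp
  rw [e3]
  refine (norm_inner_le_norm _ _).trans ?_
  rw [norm_star_L2, mul_comm, mul_right_comm]
  exact mul_le_mul_of_nonneg_right (norm_transposeMultiplier_smul_le hκ h0 h1 θ) (norm_nonneg _)

/-! ### Cutoffs and their convergence to `1` -/

/-- A smooth compactly supported function that is `1` on `[-1, 1]`. -/
noncomputable def unitCutoff : 𝓢(ℝ, ℂ) :=
  let χ : ContDiffBump (0 : ℝ) := ⟨1, 2, one_pos, one_lt_two⟩
  (χ.hasCompactSupport.comp_left (g := Complex.ofRealCLM) rfl).toSchwartzMap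
    (Complex.ofRealCLM.contDiff.comp χ.contDiff)

theorem unitCutoff_spec (x : ℝ) :
    ‖unitCutoff x‖ ≤ 1 ∧ ‖unitCutoff x - 1‖ ≤ 1 ∧ (|x| ≤ 1 → unitCutoff x = 1) := by
  let χ : ContDiffBump (0 : ℝ) := ⟨1, 2, one_pos, one_lt_two⟩
  have h : unitCutoff x = (χ x : ℂ) := rfl
  have h0 := χ.nonneg' x
  have h1 := χ.le_one (x := x)
  rw [h]
  refine ⟨?_, ?_, fun hx => ?_⟩
  · rw [Complex.norm_real, Real.norm_of_nonneg h0]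
    exact h1
  · rw [← Complex.ofReal_one, ← Complex.ofReal_sub, Complex.norm_real, Real.norm_eq_abs,
      abs_le]
    constructor <;> linarith
  · have : χ x = 1 := χ.one_of_mem_closedBall (by simpa using hx)
    simp [this]

/-- The cutoff `unitCutoff` rescaled to be `1` on `[-(n+1), n+1]`. -/
noncomputable def cutoff (n : ℕ) : 𝓢(ℝ, ℂ) :=
  SchwartzMap.compCLMOfContinuousLinearEquiv ℂ (ContinuousLinearEquiv.unitsEquivAut ℝ
    (Units.mk0 ((n : ℝ) + 1)⁻¹ (by positivity))) unitCutoff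

theorem cutoff_apply (n : ℕ) (x : ℝ) : cutoff n x = unitCutoff (((n : ℝ) + 1)⁻¹ * x) := by
  simp [cutoff, mul_comm x]

theorem norm_cutoff_le_one (n : ℕ) (x : ℝ) : ‖cutoff n x‖ ≤ 1 := by
  rw [cutoff_apply]
  exact (unitCutoff_spec _).1

/-- The difference vanishes for `|x| ≤ n + 1`, and beyond that the right side is at least `1`. -/
theorem norm_cutoff_sub_one_le (n : ℕ) (x : ℝ) : ‖cutoff n x - 1‖ ≤ ((n : ℝ) + 1)⁻¹ * |x| := by
  rw [cutoff_apply]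
  obtain ⟨-, h1, h2⟩ := unitCutoff_spec (((n : ℝ) + 1)⁻¹ * x)
  have h3 : |((n : ℝ) + 1)⁻¹ * x| = ((n : ℝ) + 1)⁻¹ * |x| := by
    rw [abs_mul, abs_of_pos (by positivity)]
  rw [h3] at h2
  rcases le_total (((n : ℝ) + 1)⁻¹ * |x|) 1 with h | h
  · rw [h2 h, sub_self, norm_zero]
    positivity
  · exact h1.trans h

theorem norm_iteratedDeriv_cutoff_le (n i : ℕ) (hi : i ≠ 0) (x : ℝ) :
    ‖iteratedDeriv i (cutoff n) x‖ ≤ ((n : ℝ) + 1)⁻¹ * SchwartzMap.seminorm ℂ 0 i unitCutoff := by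
  have h1 : ⇑(cutoff n) = fun x => unitCutoff (((n : ℝ) + 1)⁻¹ * x) := funext (cutoff_apply n)
  have h2 := iteratedDeriv_comp_const_smul (n := i) (f := unitCutoff)
    (unitCutoff.smooth i) ((n : ℝ) + 1)⁻¹
  rw [h1, h2]
  rw [norm_smul, norm_pow, Real.norm_of_nonneg (by positivity)]
  have h3 := SchwartzMap.le_seminorm' ℂ 0 i unitCutoff (((n : ℝ) + 1)⁻¹ * x)
  rw [pow_zero, one_mul] at h3
  refine mul_le_mul ?_ h3 (norm_nonneg _) (by positivity)
  exact pow_le_of_le_one (by positivity) (inv_le_one_of_one_le₀ (by simp)) hi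

theorem norm_deriv_cutoff_le (n : ℕ) (x : ℝ) :
    ‖deriv (cutoff n) x‖ ≤ SchwartzMap.seminorm ℂ 0 1 unitCutoff := by
  have h := norm_iteratedDeriv_cutoff_le n 1 one_ne_zero x
  rw [iteratedDeriv_one] at h
  exact h.trans (mul_le_of_le_one_left (apply_nonneg _ _) (inv_le_one_of_one_le₀ (by simp)))

theorem norm_iteratedFDeriv_cutoff_sub_one_le (n i : ℕ) (x : ℝ) :
    ‖iteratedFDeriv ℝ i (fun x => cutoff n x - 1) x‖ ≤
      ((n : ℝ) + 1)⁻¹ * ((1 + SchwartzMap.seminorm ℂ 0 i unitCutoff) * (1 + ‖x‖)) := by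
  have hs : 0 ≤ SchwartzMap.seminorm ℂ 0 i unitCutoff := apply_nonneg _ _
  have hn : 0 < ((n : ℝ) + 1)⁻¹ := by positivity
  rw [norm_iteratedFDeriv_eq_norm_iteratedDeriv]
  rcases eq_or_ne i 0 with rfl | hi
  · rw [iteratedDeriv_zero]
    refine (norm_cutoff_sub_one_le n x).trans (mul_le_mul_of_nonneg_left ?_ hn.le)
    rw [Real.norm_eq_abs]
    nlinarith [abs_nonneg x]
  · have : iteratedDeriv i (fun x => cutoff n x - 1) x = iteratedDeriv i (cutoff n) x := by
      obtain ⟨j, rfl⟩ := Nat.exists_eq_succ_of_ne_zero hi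
      rw [Nat.succ_eq_add_one, iteratedDeriv_succ', iteratedDeriv_succ']
      congr 1
      funext y
      simp
    rw [this]
    refine (norm_iteratedDeriv_cutoff_le n i hi x).trans (mul_le_mul_of_nonneg_left ?_ hn.le)
    nlinarith [norm_nonneg x]

/-- By Leibniz, each derivative of `cutoff n - 1` is small at the price of one power of `1 + |x|`,
which the seminorms of `θ` with weight `k + 1` absorb. -/
theorem tendsto_cutoff_smul (θ : 𝓢(ℝ, ℂ)) :
    Tendsto (fun n => SchwartzMap.smulLeftCLM ℂ (cutoff n) θ) atTop (𝓝 θ) := by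
  rw [(schwartz_withSeminorms ℂ ℝ ℂ).tendsto_nhds]
  rintro ⟨k, l⟩ ε hε
  set B : ℝ := ∑ i ∈ Finset.range (l + 1), (l.choose i : ℝ) *
    ((1 + SchwartzMap.seminorm ℂ 0 i unitCutoff) *
      (SchwartzMap.seminorm ℂ k (l - i) θ + SchwartzMap.seminorm ℂ (k + 1) (l - i) θ)) with hB
  have hB0 : 0 ≤ B := by positivity
  have hbound (n : ℕ) : SchwartzMap.seminorm ℂ k l (SchwartzMap.smulLeftCLM ℂ (cutoff n) θ - θ) ≤
      ((n : ℝ) + 1)⁻¹ * B := by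
    refine SchwartzMap.seminorm_le_bound ℂ k l _ (by positivity) fun x => ?_
    have h1 : ⇑(SchwartzMap.smulLeftCLM ℂ (cutoff n) θ - θ) =
        fun x => (cutoff n x - 1) * θ x := by
      funext y
      rw [_root_.sub_apply, SchwartzMap.smulLeftCLM_apply_apply (cutoff n).hasTemperateGrowth,
        smul_eq_mul]
      ring
    rw [h1]
    have h2 := norm_iteratedFDeriv_mul_le (𝕜 := ℝ) (f := fun x => cutoff n x - 1) (g := θ)
      (N := l) (((cutoff n).smooth l).sub contDiff_const) (θ.smooth l) x (n := l) le_rfl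
    refine (mul_le_mul_of_nonneg_left h2 (by positivity)).trans ?_
    rw [Finset.mul_sum, hB, Finset.mul_sum]
    refine Finset.sum_le_sum fun i _ => ?_
    have h3 := norm_iteratedFDeriv_cutoff_sub_one_le n i x
    have h4 := SchwartzMap.le_seminorm ℂ k (l - i) θ x
    have h5 := SchwartzMap.le_seminorm ℂ (k + 1) (l - i) θ x
    set D := ‖iteratedFDeriv ℝ (l - i) θ x‖
    set s := 1 + SchwartzMap.seminorm ℂ 0 i unitCutoff
    have hs : 0 ≤ s := by positivity
    calc ‖x‖ ^ k * ((l.choose i : ℝ) * ‖iteratedFDeriv ℝ i (fun x => cutoff n x - 1) x‖ * D)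
        ≤ ‖x‖ ^ k * ((l.choose i : ℝ) * (((n : ℝ) + 1)⁻¹ * (s * (1 + ‖x‖))) * D) := by gcongr
      _ = ((n : ℝ) + 1)⁻¹ * ((l.choose i : ℝ) * (s * (‖x‖ ^ k * D + ‖x‖ ^ (k + 1) * D))) := by ring
      _ ≤ _ := by gcongr
  have hlim : Tendsto (fun n : ℕ => ((n : ℝ) + 1)⁻¹ * B) atTop (𝓝 0) := by
    have := (tendsto_one_div_add_atTop_nhds_zero_nat (𝕜 := ℝ)).mul_const B
    simpa using this
  filter_upwards [hlim.eventually (gt_mem_nhds hε)] with n hn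
  exact (hbound n).trans_lt hn

/-! ### From a Hilbert–Schmidt operator back to `H⁻¹` -/

theorem IsFourierWeight.norm_apply_le {V : 𝓢'(ℝ, ℂ)} {w : ℝ → ℂ} (h : IsFourierWeight V w)
    {κ : ℝ} (hκ : 0 < κ) (ψ : 𝓢(ℝ, ℂ)) :
    ‖V (𝓕 (SchwartzMap.smulLeftCLM ℂ (freeSymbol κ) ψ))‖ₑ ^ 2 ≤
      ‖ψ.toLp 2‖ₑ ^ 2 * ∫⁻ ξ, ‖freeSymbol κ ξ * w ξ‖ₑ ^ 2 := by
  have hψ : ‖ψ.toLp 2‖ₑ ^ 2 = ∫⁻ ξ, ‖ψ ξ‖ₑ ^ 2 := by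
    rw [enorm_sq_eq_lintegral]
    refine lintegral_congr_ae ?_
    filter_upwards [ψ.coeFn_toLp 2] with ξ hξ
    rw [hξ]
  rw [h.apply_fourier, hψ]
  refine le_trans (le_of_eq ?_)
    (enorm_integral_mul_sq_le ψ.continuous.aestronglyMeasurable (h.memLp κ hκ).1)
  congr 2
  refine integral_congr_ae (Eventually.of_forall fun ξ => ?_)
  simp only
  rw [SchwartzMap.smulLeftCLM_apply_apply (freeSymbol_hasTemperateGrowth hκ), smul_eq_mul]
  ring

/-- Feed `A` the Schwartz function `(H₀ + κ²)^{1/2} g`: the inner inverse root cancels and what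
remains is `(H₀ + κ²)^{-1/2}(gV)`, an element of `L²`. Boundedness of `A` suffices. -/
theorem IsSandwich.memSobolev_smul {κ : ℝ} (hκ : 0 < κ) {V : 𝓢'(ℝ, ℂ)} {A : L2R →L[ℂ] L2R}
    (hA : IsSandwich κ V A) (g : 𝓢(ℝ, ℂ)) :
    TemperedDistribution.MemSobolev (-1) 2 (TemperedDistribution.smulLeftCLM ℂ g V) := by
  rw [memSobolev_neg_one_iff hκ]
  set φ : 𝓢(ℝ, ℂ) := SchwartzMap.fourierMultiplierCLM ℂ (freeSymbolInv κ) g with hφ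
  refine ⟨A (φ.toLp 2), ?_⟩
  rw [hA φ, hφ, freeInvSqrtSchwartz, SchwartzMap.fourierMultiplierCLM_fourierMultiplierCLM_apply
    (freeSymbol_hasTemperateGrowth hκ) (freeSymbolInv_hasTemperateGrowth hκ)]
  have h : freeSymbol κ * freeSymbolInv κ = fun _ => 1 :=
    funext fun ξ => freeSymbol_mul_freeSymbolInv hκ ξ
  rw [h]
  simp

theorem IsSandwich.memSobolev {κ : ℝ} (hκ : 0 < κ) {V : 𝓢'(ℝ, ℂ)} {A : L2R →L[ℂ] L2R}
    (hA : IsSandwich κ V A) (hHS : IsHilbertSchmidt A) :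
    TemperedDistribution.MemSobolev (-1) 2 V := by
  have h2κ : 0 < 2 * κ := by positivity
  set M := SchwartzMap.seminorm ℂ 0 1 unitCutoff
  set C := √(2 + 2 * M ^ 2 / κ ^ 2)
  -- The factor `κ` undoes the `1/κ` of the Hilbert–Schmidt formula; the rest is the domination
  -- bound, uniform in `n`.
  set D : ℝ≥0∞ := ENNReal.ofReal κ * (ENNReal.ofReal C ^ 2 * hsNormSq A) with hD
  have hDtop : D < ⊤ := ENNReal.mul_lt_top (by simp) (ENNReal.mul_lt_top (by simp) hHS)
  have hn (n : ℕ) (ψ : 𝓢(ℝ, ℂ)) :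
      ‖V (SchwartzMap.smulLeftCLM ℂ (cutoff n)
        (𝓕 (SchwartzMap.smulLeftCLM ℂ (freeSymbol (2 * κ)) ψ)))‖ₑ ^ 2 ≤ ‖ψ.toLp 2‖ₑ ^ 2 * D := by
    obtain ⟨w, hw⟩ := exists_isFourierWeight (hA.memSobolev_smul hκ (cutoff n))
    obtain ⟨B, hB, hBn⟩ := hw.exists_sandwich hκ
    have h1 := hsNormSq_le_of_norm_le (Real.sqrt_nonneg _)
      (hA.norm_le_of_smul hκ (norm_cutoff_le_one n) (norm_deriv_cutoff_le n) hB)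
    rw [hBn] at h1
    refine (hw.norm_apply_le h2κ ψ).trans (mul_le_mul_right ?_ _)
    have h2 := mul_le_mul_right h1 (ENNReal.ofReal κ)
    rwa [← mul_assoc, ← ENNReal.ofReal_mul hκ.le, mul_one_div_cancel hκ.ne', ENNReal.ofReal_one,
      one_mul] at h2
  have hlim (ψ : 𝓢(ℝ, ℂ)) : ‖V (𝓕 (SchwartzMap.smulLeftCLM ℂ (freeSymbol (2 * κ)) ψ))‖ₑ ^ 2 ≤
      ‖ψ.toLp 2‖ₑ ^ 2 * D := by
    -- Continuity of `V` on Schwartz space removes the cutoff, because `D` does not depend on `n`.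
    have h1 := ((V.continuous.tendsto _).comp (tendsto_cutoff_smul
      (𝓕 (SchwartzMap.smulLeftCLM ℂ (freeSymbol (2 * κ)) ψ)))).enorm
    exact le_of_tendsto ((ENNReal.continuous_pow 2).tendsto _ |>.comp h1)
      (Eventually.of_forall fun n => hn n ψ)
  set ℓ : 𝓢(ℝ, ℂ) →ₗ[ℂ] ℂ := (V.toLinearMap ∘ₗ
    (FourierTransform.fourierCLM ℂ 𝓢(ℝ, ℂ)).toLinearMap) ∘ₗ
      (SchwartzMap.smulLeftCLM ℂ (freeSymbol (2 * κ))).toLinearMap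
  obtain ⟨f, hf⟩ := exists_L2_of_norm_le ℓ (K := √D.toReal) fun ψ => by
    have h1 := ENNReal.toReal_mono (ENNReal.mul_lt_top (by simp) hDtop).ne (hlim ψ)
    rw [ENNReal.toReal_mul, ENNReal.toReal_pow, ENNReal.toReal_pow, toReal_enorm,
      toReal_enorm] at h1
    refine le_of_sq_le_sq (h1.trans_eq ?_) (by positivity)
    rw [mul_pow, Real.sq_sqrt ENNReal.toReal_nonneg, mul_comm]
  rw [memSobolev_neg_one_iff h2κ]
  refine ⟨𝓕⁻ f, ?_⟩
  rw [← Lp.fourierInv_toTemperedDistribution_eq, freeInvSqrt,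
    TemperedDistribution.fourierMultiplierCLM_apply]
  congr 1
  ext ψ
  rw [Lp.toTemperedDistribution_apply]
  exact hf ψ

/-! ### Decay in `κ` and conclusion -/

/-- The integrand decreases in `κ`, so for `κ ≥ 1` the integral is at most its value at `κ = 1` and
the prefactor `1/κ` gives the decay. -/
theorem tendsto_of_sq_eq_inv_mul_integral {N : ℝ → ℝ} {v : ℝ → ℂ} (hN : ∀ κ, 0 ≤ N κ)
    (h : ∀ κ : ℝ, 0 < κ → Integrable (fun ξ : ℝ => ‖v ξ‖ ^ 2 / (ξ ^ 2 + 4 * κ ^ 2)) ∧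
      N κ ^ 2 = 1 / κ * ∫ ξ : ℝ, ‖v ξ‖ ^ 2 / (ξ ^ 2 + 4 * κ ^ 2)) :
    Tendsto N atTop (𝓝 0) := by
  set I : ℝ := ∫ ξ : ℝ, ‖v ξ‖ ^ 2 / (ξ ^ 2 + 4 * 1 ^ 2) with hI
  have h1 : Tendsto (fun κ : ℝ => √(κ⁻¹ * I)) atTop (𝓝 0) := by
    have := (tendsto_inv_atTop_zero.mul_const I).sqrt
    simpa using this
  refine squeeze_zero' (Eventually.of_forall hN) ?_ h1
  filter_upwards [eventually_ge_atTop 1] with κ hκ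
  have hκ0 : 0 < κ := by linarith
  refine Real.le_sqrt_of_sq_le ?_
  rw [(h κ hκ0).2, one_div]
  refine mul_le_mul_of_nonneg_left ?_ (by positivity)
  refine integral_mono (h κ hκ0).1 (h 1 one_pos).1 fun ξ => ?_
  have : (1 : ℝ) ^ 2 ≤ κ ^ 2 := pow_le_pow_left₀ zero_le_one hκ 2
  simp only
  gcongr

theorem proposition3p1 (V : 𝓢'(ℝ, ℂ)) :
    (TemperedDistribution.MemSobolev (-1) 2 V →
      ∃ (v : ℝ → ℂ) (A : ℝ → L2R →L[ℂ] L2R),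
        IsFourierFunction V v ∧
        (∀ κ : ℝ, 0 < κ →
          IsSandwich κ V (A κ) ∧
          IsHilbertSchmidt (A κ) ∧
          Integrable (fun ξ : ℝ => ‖v ξ‖ ^ 2 / (ξ ^ 2 + 4 * κ ^ 2)) ∧
          hsNorm (A κ) ^ 2 = 1 / κ * ∫ ξ : ℝ, ‖v ξ‖ ^ 2 / (ξ ^ 2 + 4 * κ ^ 2)) ∧
        Tendsto (fun κ : ℝ => hsNorm (A κ)) atTop (𝓝 0)) ∧
    ∀ κ : ℝ, 0 < κ →
      ((∃ A : L2R →L[ℂ] L2R, IsSandwich κ V A ∧ IsHilbertSchmidt A) ↔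
        TemperedDistribution.MemSobolev (-1) 2 V) := by
  refine ⟨fun hV => ?_, fun κ hκ => ⟨fun ⟨A, hA, hHS⟩ => hA.memSobolev hκ hHS, fun hV => ?_⟩⟩
  · obtain ⟨w, hw⟩ := exists_isFourierWeight hV
    -- The values of `A` at `κ ≤ 0` are arbitrary and do not affect the limit at `+∞`.
    choose! A hA hA' using fun (κ : ℝ) (hκ : 0 < κ) => hw.exists_sandwich hκ
    have key (κ : ℝ) (hκ : 0 < κ) := hw.integrable_angular hκ
    set v : ℝ → ℂ := fun ξ =>
      (((2 * Real.pi) ^ (-(1 / 2) : ℝ) : ℝ) : ℂ) * w ((2 * Real.pi)⁻¹ * ξ) with hv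
    have hnorm (κ : ℝ) (hκ : 0 < κ) : hsNormSq (A κ) =
        ENNReal.ofReal (1 / κ * ∫ ξ : ℝ, ‖v ξ‖ ^ 2 / (ξ ^ 2 + 4 * κ ^ 2)) := by
      rw [hA' κ hκ, (key κ hκ).2, ENNReal.ofReal_mul (by positivity)]
    have hN (κ : ℝ) (hκ : 0 < κ) : hsNorm (A κ) ^ 2 =
        1 / κ * ∫ ξ : ℝ, ‖v ξ‖ ^ 2 / (ξ ^ 2 + 4 * κ ^ 2) := by
      rw [hsNorm, Real.sq_sqrt ENNReal.toReal_nonneg, hnorm κ hκ, ENNReal.toReal_ofReal]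
      exact mul_nonneg (by positivity) (integral_nonneg fun ξ => by positivity)
    refine ⟨v, A, hw.isFourierFunction, fun κ hκ => ⟨hA κ hκ, ?_, (key κ hκ).1, hN κ hκ⟩, ?_⟩
    · rw [IsHilbertSchmidt, hnorm κ hκ]
      exact ENNReal.ofReal_lt_top
    · exact tendsto_of_sq_eq_inv_mul_integral (fun κ => Real.sqrt_nonneg _)
        fun κ hκ => ⟨(key κ hκ).1, hN κ hκ⟩
  · obtain ⟨w, hw⟩ := exists_isFourierWeight hV
    obtain ⟨A, hA, hA'⟩ := hw.exists_sandwich hκ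
    have hm := hw.memLp (2 * κ) (by positivity)
    refine ⟨A, hA, ?_⟩
    rw [IsHilbertSchmidt, hA']
    exact ENNReal.mul_lt_top ENNReal.ofReal_lt_top ((memLp_two_iff_lintegral hm.1).1 hm)
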